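/- Let $\pi:E\to M$ be a smooth fibre bundle with $\dim M=n$ and $\dim E=n+k$. **Notation.** Indices $i,j$ run from $1$ to $n$, indices $A,B$ from $1$ to $k$, and repeated indices are summed. * $J^1\pi$ is the first jet bundle; its points over $e\in E$ are the linear maps $\tau:T_{\pi(e)}M\to T_eE$ with $\pi_*(e)\circ\tau=\mathrm{id}$ (for the jet of a local section $\phi$ at $x$: $\tau=\phi_*(x)$, $e=\phi(x)$), and $\pi_{1,0}:J^1\pi\to E$ is the projection. The contact form is $\omega^1(\tau)(X)=v-\tau(\pi_*v)\in V_e\pi=\ker\pi_*(e)$, where $v=(\pi_{1,0})_*X$. For $\eta\in T^*_{\pi(e)}M$ and $\zeta\in V_e\pi$ the vertical lift is $\eta\odot_\tau\zeta=\frac{d}{dt}(\tau+t\,\eta\otimes\zeta)|_{t=0}\in T_\tau J^1\pi$. For a $1$-form $\alpha$ on $M$, the vertical endomorphism is $S_\alpha(\tau)(X)=\alpha_{\pi(e)}\odot_\tau\omega^1(\tau)(X)$, $X\in T_\tau J^1\pi$. * $L_\pi E$ is the adapted frame bundle; its points over $e\in E$ are the bases $u=(e_i,e_A)_e$ of $T_eE$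 with $\pi_*(e)(e_A)=0$, and $\lambda:L_\pi E\to E$ is the projection. The group $G_V$ of invertible matrices $g=\begin{pmatrix}A&0\\C&B\end{pmatrix}$ ($A\in GL(n)$, $B\in GL(k)$) acts on the right by $(e_i,e_A)\cdot g=(A^j_ie_j+C^B_ie_B,\;B^B_Ae_B)$. $\theta^B$ are the components of the soldering form: $\theta^B(u)(Y)$ is the coefficient of $e_B$ in $\lambda_*Y$ with respect to $u$. $E^{*i}_B(u)=\frac{d}{dt}(u\cdot\exp(tE^i_B))|_{t=0}$, where $E^i_B$ is the matrix whose only nonzero entry is a $1$ in the row of $B$ and the column of $i$ (so in the block $C$). * $\rho:L_\pi E\to J^1\pi$ takes $(e_i,e_A)_e$ to the linear map $\pi_*(e)(e_i)\mapsto e_i$. * With $H=GL(n)\times GL(k)$, identify $G_V/H$ with the $k\times n$ matrices $\xi=(\xi^A_i)$, on which $G_V$ acts by $g\cdot\xi=CA^{-1}+B\xi A^{-1}$. A class $[u,\xi]\in L_\pi E\times_{G_V}(G_V/H)$, where $[u\cdot g,\xi]=[u,g\cdot\xi]$, is identified with the jet $\pi_*(e)(e_i)\mapsto e_i+\xi^A_ie_A$.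 Put $u\cdot\xi=(e_i+\xi^A_ie_A,\;e_A)_e\in L_\pi E$. **Proposition.** Let $\alpha$ be any $1$-form on $M$, $u=(e_i,e_A)_e\in L_\pi E$ and $\xi$ a real $k\times n$ matrix. 1. $\rho(u\cdot\xi)=[u,\xi]$, and for all $X\in T_{[u,\xi]}J^1\pi$ and $\tilde X\in T_{u\cdot\xi}L_\pi E$ that project onto the same vector on $E$, i.e. $(\pi_{1,0})_*X=\lambda_*\tilde X$, $$S_\alpha([u,\xi])(X)=\rho_*(u\cdot\xi)\Big((\pi^*\alpha)_e(e_i)\,\big(E^{*i}_B\otimes\theta^B\big)(u\cdot\xi)(\tilde X)\Big).$$ 2. The right-hand side does not depend on the representative: if $[u,\xi]=[\bar u,\bar\xi]$ with $\bar u=(\bar e_i,\bar e_A)_e$, and $\tilde X\in T_{u\cdot\xi}L_\pi E$ and $\bar X\in T_{\bar u\cdot\bar\xi}L_\pi E$ project onto the same vector on $E$, then $$\rho_*(u\cdot\xi)\Big((\pi^*\alpha)_e(e_i)\,(E^{*i}_B\otimes\theta^B)(u\cdot\xi)(\tilde X)\Big)=\rho_*(\bar u\cdot\bar\xi)\Big((\pi^*\alpha)_e(\bar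 e_i)\,(E^{*i}_B\otimes\theta^B)(\bar u\cdot\bar\xi)(\bar X)\Big).$$ -/

import Mathlib

open Set Function
open scoped Manifold ContDiff Topology

/-! ### Fibre bundles and adapted coordinates -/

section Bundles

/-- The tangent space at `x` of a manifold of dimension `d`. -/
abbrev TSp (d : ℕ) {N : Type*} [TopologicalSpace N] [ChartedSpace (EuclideanSpace ℝ (Fin d)) N]
    (x : N) : Type :=
  TangentSpace 𝓘(ℝ, EuclideanSpace ℝ (Fin d)) x

/-- A smooth fibre bundle `π : E → M` with typical fibre `F`, where `dim M = n`, `dim F = k` and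
`dim E = n + k`. -/
structure SmoothFiberBundle (n k : ℕ) (F E M : Type*)
    [TopologicalSpace F] [ChartedSpace (EuclideanSpace ℝ (Fin k)) F]
    [TopologicalSpace E] [ChartedSpace (EuclideanSpace ℝ (Fin (n + k))) E]
    [TopologicalSpace M] [ChartedSpace (EuclideanSpace ℝ (Fin n)) M] where
  /-- the projection `π` -/
  proj : E → M
  contMDiff_proj : ContMDiff 𝓘(ℝ, EuclideanSpace ℝ (Fin (n + k)))
    𝓘(ℝ, EuclideanSpace ℝ (Fin n)) ∞ proj
  /-- around each point of `M` there is a local trivialization that is a diffeomorphism -/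
  locallyTrivial : ∀ x : M, ∃ t : Bundle.Trivialization F proj, x ∈ t.baseSet ∧
    ContMDiffOn 𝓘(ℝ, EuclideanSpace ℝ (Fin (n + k)))
      (𝓘(ℝ, EuclideanSpace ℝ (Fin n)).prod 𝓘(ℝ, EuclideanSpace ℝ (Fin k))) ∞
      t.toOpenPartialHomeomorph t.source ∧
    ContMDiffOn (𝓘(ℝ, EuclideanSpace ℝ (Fin n)).prod 𝓘(ℝ, EuclideanSpace ℝ (Fin k)))
      𝓘(ℝ, EuclideanSpace ℝ (Fin (n + k))) ∞
      t.toOpenPartialHomeomorph.symm t.target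

variable {n k : ℕ} {F E M : Type*}
  [TopologicalSpace F] [ChartedSpace (EuclideanSpace ℝ (Fin k)) F]
  [TopologicalSpace E] [ChartedSpace (EuclideanSpace ℝ (Fin (n + k))) E]
  [TopologicalSpace M] [ChartedSpace (EuclideanSpace ℝ (Fin n)) M]

namespace SmoothFiberBundle

/-- The tangent map `π_*(e) : T_e E → T_{π(e)} M`. -/
noncomputable def dproj (P : SmoothFiberBundle n k F E M) (e : E) :
    TSp (n + k) e →L[ℝ] TSp n (P.proj e) :=
  mfderiv 𝓘(ℝ, EuclideanSpace ℝ (Fin (n + k))) 𝓘(ℝ, EuclideanSpace ℝ (Fin n)) P.proj e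

/-- Adapted coordinates `(x^i, y^A)` on an open set of `E`, over coordinates `(x^i)` on an open set
of `M`. -/
structure AdaptedChart (P : SmoothFiberBundle n k F E M) where
  φ : OpenPartialHomeomorph E (EuclideanSpace ℝ (Fin n) × EuclideanSpace ℝ (Fin k))
  ψ : OpenPartialHomeomorph M (EuclideanSpace ℝ (Fin n))
  contMDiffOn_φ : ContMDiffOn 𝓘(ℝ, EuclideanSpace ℝ (Fin (n + k)))
    𝓘(ℝ, EuclideanSpace ℝ (Fin n) × EuclideanSpace ℝ (Fin k)) ∞ φ φ.source
  contMDiffOn_φ_symm : ContMDiffOn 𝓘(ℝ, EuclideanSpace ℝ (Fin n) × EuclideanSpace ℝ (Fin k))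
    𝓘(ℝ, EuclideanSpace ℝ (Fin (n + k))) ∞ φ.symm φ.target
  contMDiffOn_ψ : ContMDiffOn 𝓘(ℝ, EuclideanSpace ℝ (Fin n))
    𝓘(ℝ, EuclideanSpace ℝ (Fin n)) ∞ ψ ψ.source
  contMDiffOn_ψ_symm : ContMDiffOn 𝓘(ℝ, EuclideanSpace ℝ (Fin n))
    𝓘(ℝ, EuclideanSpace ℝ (Fin n)) ∞ ψ.symm ψ.target
  proj_mem : ∀ e ∈ φ.source, P.proj e ∈ ψ.source
  fst_eq : ∀ e ∈ φ.source, (φ e).1 = ψ (P.proj e)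

theorem exists_adaptedChart (P : SmoothFiberBundle n k F E M)
    [IsManifold 𝓘(ℝ, EuclideanSpace ℝ (Fin k)) ∞ F] [IsManifold 𝓘(ℝ, EuclideanSpace ℝ (Fin n)) ∞ M]
    (e : E) : ∃ c : P.AdaptedChart, e ∈ c.φ.source := by
  obtain ⟨t, hx, ht, ht'⟩ := P.locallyTrivial (P.proj e)
  set a := chartAt (EuclideanSpace ℝ (Fin n)) (P.proj e)
  set f : F := (t e).2
  set b := chartAt (EuclideanSpace ℝ (Fin k)) f
  have ha : ContMDiffOn 𝓘(ℝ, EuclideanSpace ℝ (Fin n)) 𝓘(ℝ, EuclideanSpace ℝ (Fin n)) ∞ a a.source :=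
    contMDiffOn_chart
  have ha' : ContMDiffOn 𝓘(ℝ, EuclideanSpace ℝ (Fin n)) 𝓘(ℝ, EuclideanSpace ℝ (Fin n)) ∞
    a.symm a.target := contMDiffOn_chart_symm
  have hb : ContMDiffOn 𝓘(ℝ, EuclideanSpace ℝ (Fin k)) 𝓘(ℝ, EuclideanSpace ℝ (Fin k)) ∞ b b.source :=
    contMDiffOn_chart
  have hb' : ContMDiffOn 𝓘(ℝ, EuclideanSpace ℝ (Fin k)) 𝓘(ℝ, EuclideanSpace ℝ (Fin k)) ∞
    b.symm b.target := contMDiffOn_chart_symm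
  have hsrc : ∀ y, y ∈ (t.toOpenPartialHomeomorph.trans (a.prod b)).source →
      y ∈ t.source ∧ P.proj y ∈ a.source ∧ (t y).2 ∈ b.source ∧ (t y).1 = P.proj y := by
    intro y hy
    have h1 : y ∈ t.source := hy.1
    have h2 := hy.2
    have h3 : (t y).1 = P.proj y := t.proj_toFun y h1
    exact ⟨h1, h3 ▸ h2.1, h2.2, h3⟩
  refine ⟨⟨t.toOpenPartialHomeomorph.trans (a.prod b), a, ?_, ?_, ha, ha', ?_, ?_⟩, ?_⟩
  · have h1 : ContMDiffOn 𝓘(ℝ, EuclideanSpace ℝ (Fin (n + k))) 𝓘(ℝ, EuclideanSpace ℝ (Fin n)) ∞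
        (fun y => a (t y).1) (t.toOpenPartialHomeomorph.trans (a.prod b)).source := by
      refine ha.comp (t := a.source) (contMDiff_fst.comp_contMDiffOn (ht.mono fun y hy => (hsrc y hy).1)) ?_
      intro y hy
      exact hy.2.1
    have h2 : ContMDiffOn 𝓘(ℝ, EuclideanSpace ℝ (Fin (n + k))) 𝓘(ℝ, EuclideanSpace ℝ (Fin k)) ∞
        (fun y => b (t y).2) (t.toOpenPartialHomeomorph.trans (a.prod b)).source := by
      refine hb.comp (t := b.source) (contMDiff_snd.comp_contMDiffOn (ht.mono fun y hy => (hsrc y hy).1)) ?_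
      intro y hy
      exact hy.2.2
    exact h1.prodMk_space h2
  · have h0 : (t.toOpenPartialHomeomorph.trans (a.prod b)).target ⊆ (a.prod b).target :=
      fun y hy => hy.1
    have h1 : ContMDiffOn 𝓘(ℝ, EuclideanSpace ℝ (Fin n) × EuclideanSpace ℝ (Fin k))
        (𝓘(ℝ, EuclideanSpace ℝ (Fin n)).prod 𝓘(ℝ, EuclideanSpace ℝ (Fin k))) ∞
        (a.prod b).symm (a.prod b).target := by
      refine ContMDiffOn.prodMk
        (f := fun z : EuclideanSpace ℝ (Fin n) × EuclideanSpace ℝ (Fin k) => a.symm z.1)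
        (g := fun z : EuclideanSpace ℝ (Fin n) × EuclideanSpace ℝ (Fin k) => b.symm z.2) ?_ ?_
      · exact ha'.comp (contDiff_fst.contMDiff.contMDiffOn) fun y hy => hy.1
      · exact hb'.comp (contDiff_snd.contMDiff.contMDiffOn) fun y hy => hy.2
    exact ht'.comp (h1.mono h0) fun y hy => hy.2
  · intro y hy; exact (hsrc y hy).2.1
  · intro y hy
    change a (t y).1 = a (P.proj y)
    rw [(hsrc y hy).2.2.2]
  · have h1 : e ∈ t.source := by rw [t.source_eq]; exact hx
    have h3 : (t e).1 = P.proj e := t.proj_toFun e h1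
    refine ⟨h1, ?_, mem_chart_source _ _⟩
    change (t e).1 ∈ a.source
    rw [h3]; exact mem_chart_source _ _

end SmoothFiberBundle

end Bundles
/-! ### Manifolds from coordinate systems -/

section CoordinateSystems

/-- A smooth atlas on a bare set `X`: injective coordinate maps `coord i`, defined on the sets
`dom i` that cover `X`, with values in a normed space, such that the overlaps have open images and
the changes of coordinates are smooth. -/
structure CoordinateSystem (X : Type*) (H : Type*) [NormedAddCommGroup H] [NormedSpace ℝ H] where
  ι : Type*
  coord : ι → X → H
  dom : ι → Set X
  injOn : ∀ i, InjOn (coord i) (dom i)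
  cover : ∀ x, ∃ i, x ∈ dom i
  isOpen_image : ∀ i j, IsOpen (coord i '' (dom i ∩ dom j))
  smooth : ∀ i j, ∃ T : H → H, ContDiffOn ℝ ∞ T (coord i '' (dom i ∩ dom j)) ∧
    ∀ x ∈ dom i ∩ dom j, T (coord i x) = coord j x

namespace CoordinateSystem

variable {X H : Type*} [NormedAddCommGroup H] [NormedSpace ℝ H]

/-- The chart given by the coordinate map `coord i`, with domain `dom i`; the point `x₀` only
provides a value of the inverse outside of `coord i '' dom i`. -/
noncomputable def chart (C : CoordinateSystem X H) (x₀ : X) (i : C.ι) : PartialEquiv X H :=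
  haveI : Nonempty X := ⟨x₀⟩
  BijOn.toPartialEquiv (C.coord i) (C.dom i) (C.coord i '' C.dom i) (C.injOn i).bijOn_image

theorem chart_trans_source (C : CoordinateSystem X H) (x y : X) (i j : C.ι) :
    ((C.chart x i).symm.trans (C.chart y j)).source = C.coord i '' (C.dom i ∩ C.dom j) := by
  ext z
  constructor
  · rintro ⟨hz, hz'⟩
    exact ⟨(C.chart x i).symm z, ⟨(C.chart x i).map_target hz, hz'⟩, (C.chart x i).right_inv hz⟩
  · rintro ⟨p, ⟨hp, hp'⟩, rfl⟩
    refine ⟨(C.chart x i).map_source hp, ?_⟩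
    have : (C.chart x i).symm (C.coord i p) = p := (C.chart x i).left_inv hp
    change (C.chart x i).symm (C.coord i p) ∈ C.dom j
    rw [this]; exact hp'

theorem contDiffOn_chart_trans (C : CoordinateSystem X H) (x y : X) (i j : C.ι) :
    ContDiffOn ℝ ∞ ((C.chart x i).symm.trans (C.chart y j))
      ((C.chart x i).symm.trans (C.chart y j)).source := by
  rw [chart_trans_source]
  obtain ⟨T, hT, hT'⟩ := C.smooth i j
  refine hT.congr ?_
  rintro _ ⟨p, hp, rfl⟩
  rw [hT' p hp]
  have : (C.chart x i).symm (C.coord i p) = p := (C.chart x i).left_inv hp.1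
  change C.coord j ((C.chart x i).symm (C.coord i p)) = C.coord j p
  rw [this]

/-- The charts `coord i` as an atlas in the sense of Mathlib. -/
noncomputable def core (C : CoordinateSystem X H) : ChartedSpaceCore H X where
  atlas := {e | ∃ x i, e = C.chart x i}
  chartAt x := C.chart x (C.cover x).choose
  mem_chart_source x := (C.cover x).choose_spec
  chart_mem_atlas x := ⟨x, _, rfl⟩
  open_source := by
    rintro _ _ ⟨x, i, rfl⟩ ⟨y, j, rfl⟩
    rw [chart_trans_source]
    exact C.isOpen_image i j
  continuousOn_toFun := by
    rintro _ _ ⟨x, i, rfl⟩ ⟨y, j, rfl⟩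
    exact (C.contDiffOn_chart_trans x y i j).continuousOn

/-- The topology in which the coordinate maps are homeomorphisms onto their images. -/
@[reducible] noncomputable def topology (C : CoordinateSystem X H) : TopologicalSpace X :=
  C.core.toTopologicalSpace

/-- The manifold structure with the coordinate maps as charts. -/
@[reducible] noncomputable def chartedSpace (C : CoordinateSystem X H) :
    @ChartedSpace H _ X C.topology :=
  C.core.toChartedSpace

theorem isManifold (C : CoordinateSystem X H) :
    @IsManifold ℝ _ H _ _ H _ 𝓘(ℝ, H) ∞ X C.topology C.chartedSpace := by
  let _ := C.topology
  let _ := C.chartedSpace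
  refine isManifold_of_contDiffOn 𝓘(ℝ, H) ∞ X ?_
  intro e e' he he'
  obtain ⟨e, he⟩ := mem_iUnion.1 he
  obtain ⟨⟨x, i, rfl⟩, rfl⟩ := mem_iUnion.1 he
  obtain ⟨e', he'⟩ := mem_iUnion.1 he'
  obtain ⟨⟨y, j, rfl⟩, rfl⟩ := mem_iUnion.1 he'
  simp only [modelWithCornersSelf_coe, modelWithCornersSelf_coe_symm, Function.comp_id,
    Function.id_comp, preimage_id, range_id, inter_univ]
  exact C.contDiffOn_chart_trans x y i j

end CoordinateSystem

end CoordinateSystems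
/-! ### The first jet bundle and the adapted frame bundle -/

section Jets

variable {n k : ℕ} {F E M : Type*}
  [TopologicalSpace F] [ChartedSpace (EuclideanSpace ℝ (Fin k)) F]
  [TopologicalSpace E] [ChartedSpace (EuclideanSpace ℝ (Fin (n + k))) E]
  [TopologicalSpace M] [ChartedSpace (EuclideanSpace ℝ (Fin n)) M]

namespace SmoothFiberBundle

namespace AdaptedChart

variable {P : SmoothFiberBundle n k F E M}

theorem mdifferentiable_φ (c : P.AdaptedChart) :
    c.φ.MDifferentiable 𝓘(ℝ, EuclideanSpace ℝ (Fin (n + k)))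
      𝓘(ℝ, EuclideanSpace ℝ (Fin n) × EuclideanSpace ℝ (Fin k)) :=
  ⟨c.contMDiffOn_φ.mdifferentiableOn (by simp), c.contMDiffOn_φ_symm.mdifferentiableOn (by simp)⟩

theorem mdifferentiable_ψ (c : P.AdaptedChart) :
    c.ψ.MDifferentiable 𝓘(ℝ, EuclideanSpace ℝ (Fin n)) 𝓘(ℝ, EuclideanSpace ℝ (Fin n)) :=
  ⟨c.contMDiffOn_ψ.mdifferentiableOn (by simp), c.contMDiffOn_ψ_symm.mdifferentiableOn (by simp)⟩

/-- The components `(dx^i, dy^A)` of tangent vectors of `E` at `e`. -/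
noncomputable def dφ (c : P.AdaptedChart) (e : E) :
    TSp (n + k) e →L[ℝ] EuclideanSpace ℝ (Fin n) × EuclideanSpace ℝ (Fin k) :=
  mfderiv 𝓘(ℝ, EuclideanSpace ℝ (Fin (n + k)))
    𝓘(ℝ, EuclideanSpace ℝ (Fin n) × EuclideanSpace ℝ (Fin k)) c.φ e

/-- The components `(dx^i)` of tangent vectors of `M` at `x`. -/
noncomputable def dψ (c : P.AdaptedChart) (x : M) :
    TSp n x →L[ℝ] EuclideanSpace ℝ (Fin n) :=
  mfderiv 𝓘(ℝ, EuclideanSpace ℝ (Fin n)) 𝓘(ℝ, EuclideanSpace ℝ (Fin n)) c.ψ x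

theorem exists_dφ_equiv (c : P.AdaptedChart) {e : E} (he : e ∈ c.φ.source) :
    ∃ L : TSp (n + k) e ≃L[ℝ] EuclideanSpace ℝ (Fin n) × EuclideanSpace ℝ (Fin k),
      ∀ v, L v = c.dφ e v :=
  ⟨c.mdifferentiable_φ.mfderiv he, fun _ => rfl⟩

theorem exists_dψ_equiv (c : P.AdaptedChart) {x : M} (hx : x ∈ c.ψ.source) :
    ∃ L : TSp n x ≃L[ℝ] EuclideanSpace ℝ (Fin n), ∀ v, L v = c.dψ x v :=
  ⟨c.mdifferentiable_ψ.mfderiv hx, fun _ => rfl⟩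

theorem fst_dφ (c : P.AdaptedChart) {e : E} (he : e ∈ c.φ.source) (v : TSp (n + k) e) :
    (c.dφ e v).1 = c.dψ (P.proj e) (P.dproj e v) := by
  have h1 : HasMFDerivAt 𝓘(ℝ, EuclideanSpace ℝ (Fin (n + k))) 𝓘(ℝ, EuclideanSpace ℝ (Fin n))
      (fun y => (c.φ y).1) e
      ((ContinuousLinearMap.fst ℝ (EuclideanSpace ℝ (Fin n)) (EuclideanSpace ℝ (Fin k))).comp
        (c.dφ e)) :=
    HasMFDerivAt.comp e (I' := 𝓘(ℝ, EuclideanSpace ℝ (Fin n) × EuclideanSpace ℝ (Fin k)))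
      (g := Prod.fst) (hasFDerivAt_fst.hasMFDerivAt)
      (c.mdifferentiable_φ.mdifferentiableAt he).hasMFDerivAt
  have h2 : HasMFDerivAt 𝓘(ℝ, EuclideanSpace ℝ (Fin (n + k))) 𝓘(ℝ, EuclideanSpace ℝ (Fin n))
      (fun y => c.ψ (P.proj y)) e ((c.dψ (P.proj e)).comp (P.dproj e)) :=
    HasMFDerivAt.comp e
      (c.mdifferentiable_ψ.mdifferentiableAt (c.proj_mem e he)).hasMFDerivAt
      ((P.contMDiff_proj.mdifferentiable (by simp)) e).hasMFDerivAt
  have h3 : (fun y => (c.φ y).1) =ᶠ[𝓝 e] fun y => c.ψ (P.proj y) :=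
    Filter.eventually_of_mem (c.φ.open_source.mem_nhds he) c.fst_eq
  exact congrArg (fun L => L v) (hasMFDerivAt_unique h1 (h2.congr_of_eventuallyEq h3))

theorem dφ_change (c c' : P.AdaptedChart) {e : E} (he : e ∈ c.φ.source) (he' : e ∈ c'.φ.source)
    (v : TSp (n + k) e) :
    c'.dφ e v = fderiv ℝ (c'.φ ∘ c.φ.symm) (c.φ e) (c.dφ e v) := by
  have h0 : c.φ.symm (c.φ e) = e := c.φ.left_inv he
  have h1 : MDifferentiableAt 𝓘(ℝ, EuclideanSpace ℝ (Fin n) × EuclideanSpace ℝ (Fin k))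
      𝓘(ℝ, EuclideanSpace ℝ (Fin n) × EuclideanSpace ℝ (Fin k)) (c'.φ ∘ c.φ.symm) (c.φ e) := by
    refine MDifferentiableAt.comp (c.φ e) (I' := 𝓘(ℝ, EuclideanSpace ℝ (Fin (n + k)))) ?_
      (c.mdifferentiable_φ.mdifferentiableAt_symm (c.φ.map_source he))
    rw [h0]
    exact c'.mdifferentiable_φ.mdifferentiableAt he'
  have h2 := HasMFDerivAt.comp e h1.hasMFDerivAt
    (c.mdifferentiable_φ.mdifferentiableAt he).hasMFDerivAt
  have h3 : c'.φ =ᶠ[𝓝 e] (c'.φ ∘ c.φ.symm) ∘ c.φ :=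
    Filter.eventually_of_mem (c.φ.open_source.mem_nhds he) fun y hy => by
      simp [c.φ.left_inv hy]
  have h4 := hasMFDerivAt_unique (c'.mdifferentiable_φ.mdifferentiableAt he').hasMFDerivAt
    (h2.congr_of_eventuallyEq h3)
  rw [mfderiv_eq_fderiv] at h4
  exact congrArg (fun L => L v) h4

theorem dψ_change (c c' : P.AdaptedChart) {x : M} (hx : x ∈ c.ψ.source) (hx' : x ∈ c'.ψ.source)
    (v : TSp n x) :
    c'.dψ x v = fderiv ℝ (c'.ψ ∘ c.ψ.symm) (c.ψ x) (c.dψ x v) := by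
  have h0 : c.ψ.symm (c.ψ x) = x := c.ψ.left_inv hx
  have h1 : MDifferentiableAt 𝓘(ℝ, EuclideanSpace ℝ (Fin n))
      𝓘(ℝ, EuclideanSpace ℝ (Fin n)) (c'.ψ ∘ c.ψ.symm) (c.ψ x) := by
    refine MDifferentiableAt.comp (c.ψ x) (I' := 𝓘(ℝ, EuclideanSpace ℝ (Fin n))) ?_
      (c.mdifferentiable_ψ.mdifferentiableAt_symm (c.ψ.map_source hx))
    rw [h0]
    exact c'.mdifferentiable_ψ.mdifferentiableAt hx'
  have h2 := HasMFDerivAt.comp x h1.hasMFDerivAt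
    (c.mdifferentiable_ψ.mdifferentiableAt hx).hasMFDerivAt
  have h3 : c'.ψ =ᶠ[𝓝 x] (c'.ψ ∘ c.ψ.symm) ∘ c.ψ :=
    Filter.eventually_of_mem (c.ψ.open_source.mem_nhds hx) fun y hy => by
      simp [c.ψ.left_inv hy]
  have h4 := hasMFDerivAt_unique (c'.mdifferentiable_ψ.mdifferentiableAt hx').hasMFDerivAt
    (h2.congr_of_eventuallyEq h3)
  rw [mfderiv_eq_fderiv] at h4
  exact congrArg (fun L => L v) h4

/-- The image under `φ` of the overlap of two adapted coordinate domains. -/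
def overlap (c c' : P.AdaptedChart) : Set (EuclideanSpace ℝ (Fin n) × EuclideanSpace ℝ (Fin k)) :=
  (c.φ.symm.trans c'.φ).source

theorem isOpen_overlap (c c' : P.AdaptedChart) : IsOpen (c.overlap c') :=
  (c.φ.symm.trans c'.φ).open_source

theorem mem_overlap (c c' : P.AdaptedChart) {e : E} (he : e ∈ c.φ.source) (he' : e ∈ c'.φ.source) :
    c.φ e ∈ c.overlap c' := by
  refine ⟨c.φ.map_source he, ?_⟩
  change c.φ.symm (c.φ e) ∈ c'.φ.source
  rw [c.φ.left_inv he]; exact he'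

theorem exists_of_mem_overlap (c c' : P.AdaptedChart)
    {w : EuclideanSpace ℝ (Fin n) × EuclideanSpace ℝ (Fin k)} (hw : w ∈ c.overlap c') :
    ∃ e, e ∈ c.φ.source ∧ e ∈ c'.φ.source ∧ c.φ e = w :=
  ⟨c.φ.symm w, c.φ.map_target hw.1, hw.2, c.φ.right_inv hw.1⟩

theorem contDiffOn_change (c c' : P.AdaptedChart) :
    ContDiffOn ℝ ∞ (c'.φ ∘ c.φ.symm) (c.overlap c') := by
  rw [← contMDiffOn_iff_contDiffOn]
  exact c'.contMDiffOn_φ.comp (c.contMDiffOn_φ_symm.mono fun w hw => hw.1) fun w hw => hw.2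

theorem contDiffOn_change_base (c c' : P.AdaptedChart) :
    ContDiffOn ℝ ∞ (c.ψ ∘ c'.ψ.symm) (c'.ψ.symm.trans c.ψ).source := by
  rw [← contMDiffOn_iff_contDiffOn]
  exact c.contMDiffOn_ψ.comp (c'.contMDiffOn_ψ_symm.mono fun w hw => hw.1) fun w hw => hw.2

theorem fst_change_mem (c c' : P.AdaptedChart)
    {w : EuclideanSpace ℝ (Fin n) × EuclideanSpace ℝ (Fin k)} (hw : w ∈ c.overlap c') :
    ((c'.φ ∘ c.φ.symm) w).1 ∈ (c'.ψ.symm.trans c.ψ).source := by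
  obtain ⟨e, he, he', rfl⟩ := c.exists_of_mem_overlap c' hw
  have h0 : (c'.φ ∘ c.φ.symm) (c.φ e) = c'.φ e := congrArg c'.φ (c.φ.left_inv he)
  rw [h0, c'.fst_eq e he']
  refine ⟨c'.ψ.map_source (c'.proj_mem e he'), ?_⟩
  change c'.ψ.symm (c'.ψ (P.proj e)) ∈ c.ψ.source
  rw [c'.ψ.left_inv (c'.proj_mem e he')]
  exact c.proj_mem e he

end AdaptedChart

theorem dproj_surjective (P : SmoothFiberBundle n k F E M)
    [IsManifold 𝓘(ℝ, EuclideanSpace ℝ (Fin k)) ∞ F] [IsManifold 𝓘(ℝ, EuclideanSpace ℝ (Fin n)) ∞ M]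
    (e : E) : Surjective (P.dproj e) := by
  obtain ⟨c, he⟩ := P.exists_adaptedChart e
  obtain ⟨L, hL⟩ := c.exists_dφ_equiv he
  obtain ⟨L', hL'⟩ := c.exists_dψ_equiv (c.proj_mem e he)
  intro w
  refine ⟨L.symm (L' w, 0), L'.injective ?_⟩
  rw [hL', ← c.fst_dφ he, ← hL]
  simp

/-- The first jet bundle `J¹π`: a point is a linear right inverse `τ : T_{π(e)} M → T_e E` of
`π_*(e)`, for some `e ∈ E`. The jet at `x` of a local section `φ` is `τ = φ_*(x)`, `e = φ(x)`. -/
@[ext] structure Jet1 (P : SmoothFiberBundle n k F E M) where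
  /-- the projection `π_{1,0} : J¹π → E` -/
  pt : E
  τ : TSp n (P.proj pt) →L[ℝ] TSp (n + k) pt
  right_inv : ∀ w, P.dproj pt (τ w) = w

/-- The adapted frame bundle `L_π E`: a point is a basis `(e_i, e_A)` of `T_e E`, for some `e ∈ E`,
with `π_*(e)(e_A) = 0`. -/
@[ext] structure AdaptedFrame (P : SmoothFiberBundle n k F E M) where
  /-- the projection `λ : L_π E → E` -/
  pt : E
  frame : Module.Basis (Fin n ⊕ Fin k) ℝ (TSp (n + k) pt)
  vertical : ∀ A : Fin k, P.dproj pt (frame (Sum.inr A)) = 0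

variable {P : SmoothFiberBundle n k F E M}

/-- The coordinate space of the jet coordinates `(x^i, y^A, y^A_i)`. -/
abbrev JetModel (n k : ℕ) : Type :=
  (EuclideanSpace ℝ (Fin n) × EuclideanSpace ℝ (Fin k)) ×
    (EuclideanSpace ℝ (Fin n) →L[ℝ] EuclideanSpace ℝ (Fin k))

/-- The coordinate space of the frame coordinates `(x^i, y^A, v^i_j, v^A_j, v^A_B)`. -/
abbrev FrameModel (n k : ℕ) : Type :=
  (EuclideanSpace ℝ (Fin n) × EuclideanSpace ℝ (Fin k)) ×
    (Fin n → EuclideanSpace ℝ (Fin n) × EuclideanSpace ℝ (Fin k)) ×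
    (Fin k → EuclideanSpace ℝ (Fin k))

namespace Jet1

/-- The jet coordinates `(x^i, y^A, y^A_i)`; here `(y^A_i)` is the matrix of the linear map
`∂/∂x^i ↦ y^A_i ∂/∂y^A`, the vertical part of `τ`. -/
noncomputable def coord (c : P.AdaptedChart) (j : P.Jet1) :
    JetModel n k :=
  (c.φ j.pt, (ContinuousLinearMap.snd ℝ (EuclideanSpace ℝ (Fin n)) (EuclideanSpace ℝ (Fin k))) ∘L
    (c.dφ j.pt) ∘L j.τ ∘L (c.dψ (P.proj j.pt)).inverse)

theorem dφ_τ (c : P.AdaptedChart) (j : P.Jet1) (hj : j.pt ∈ c.φ.source) (w : TSp n (P.proj j.pt)) :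
    c.dφ j.pt (j.τ w) = (c.dψ _ w, (coord c j).2 (c.dψ _ w)) := by
  obtain ⟨L, hL⟩ := c.exists_dψ_equiv (c.proj_mem _ hj)
  have hL' : c.dψ (P.proj j.pt) = (L : _ →L[ℝ] _) := by ext1 v; exact (hL v).symm
  refine Prod.ext ?_ ?_
  · rw [c.fst_dφ hj, j.right_inv]
  · simp [coord, hL']

/-- The jet over `e` with given coordinates `y^A_i`. -/
theorem exists_coord (c : P.AdaptedChart) {e : E} (he : e ∈ c.φ.source)
    (p : EuclideanSpace ℝ (Fin n) →L[ℝ] EuclideanSpace ℝ (Fin k)) :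
    ∃ j : P.Jet1, j.pt = e ∧ coord c j = (c.φ e, p) := by
  obtain ⟨L, hL⟩ := c.exists_dψ_equiv (c.proj_mem _ he)
  obtain ⟨K, hK⟩ := c.exists_dφ_equiv he
  have hL' : c.dψ (P.proj e) = (L : _ →L[ℝ] _) := by ext1 v; exact (hL v).symm
  have hK' : c.dφ e = (K : _ →L[ℝ] _) := by ext1 v; exact (hK v).symm
  refine ⟨⟨e, (K.symm : _ →L[ℝ] _) ∘L
    ((ContinuousLinearMap.id ℝ (EuclideanSpace ℝ (Fin n))).prod p) ∘L (L : _ →L[ℝ] _), ?_⟩, rfl, ?_⟩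
  · intro w
    apply L.injective
    rw [hL, ← c.fst_dφ he, ← hK]
    simp
  · refine Prod.ext rfl ?_
    ext1 v
    simp [coord, hL', hK']

theorem coord_injOn (c : P.AdaptedChart) : InjOn (coord c) {j : P.Jet1 | j.pt ∈ c.φ.source} := by
  intro j hj j' hj' h
  have hpt : j.pt = j'.pt := c.φ.injOn hj hj' (congrArg Prod.fst h)
  have h2 := congrArg Prod.snd h
  have h3 := dφ_τ c j hj
  have h4 := dφ_τ c j' hj'
  rw [← h2] at h4
  obtain ⟨K, hK⟩ := c.exists_dφ_equiv hj
  generalize (coord c j).2 = p at h3 h4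
  clear h h2
  obtain ⟨e, τ, hτ⟩ := j
  obtain ⟨e', τ', hτ'⟩ := j'
  obtain rfl : e = e' := hpt
  congr 1
  ext1 w
  apply K.injective
  rw [hK, hK]
  exact (h3 w).trans (h4 w).symm

theorem image_overlap (c c' : P.AdaptedChart) :
    coord c '' ({j : P.Jet1 | j.pt ∈ c.φ.source} ∩ {j : P.Jet1 | j.pt ∈ c'.φ.source}) =
      Prod.fst ⁻¹' c.overlap c' := by
  ext ⟨w, p⟩
  constructor
  · rintro ⟨j, ⟨hj, hj'⟩, h⟩
    have : c.φ j.pt = w := congrArg Prod.fst h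
    exact this ▸ c.mem_overlap c' hj hj'
  · intro h
    obtain ⟨e, he, he', rfl⟩ := c.exists_of_mem_overlap c' h
    obtain ⟨j, rfl, hj⟩ := exists_coord c he p
    exact ⟨j, ⟨he, he'⟩, hj⟩

/-- The change of jet coordinates. -/
noncomputable def change (c c' : P.AdaptedChart)
    (z : JetModel n k) :
    JetModel n k :=
  ((c'.φ ∘ c.φ.symm) z.1,
    (ContinuousLinearMap.snd ℝ (EuclideanSpace ℝ (Fin n)) (EuclideanSpace ℝ (Fin k))) ∘L
      (fderiv ℝ (c'.φ ∘ c.φ.symm) z.1) ∘L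
      (ContinuousLinearMap.inl ℝ (EuclideanSpace ℝ (Fin n)) (EuclideanSpace ℝ (Fin k)) +
        (ContinuousLinearMap.inr ℝ (EuclideanSpace ℝ (Fin n)) (EuclideanSpace ℝ (Fin k))) ∘L z.2) ∘L
      (fderiv ℝ (c.ψ ∘ c'.ψ.symm) ((c'.φ ∘ c.φ.symm) z.1).1))

theorem change_coord (c c' : P.AdaptedChart) (j : P.Jet1) (hj : j.pt ∈ c.φ.source)
    (hj' : j.pt ∈ c'.φ.source) : change c c' (coord c j) = coord c' j := by
  have h0 : (c'.φ ∘ c.φ.symm) (c.φ j.pt) = c'.φ j.pt := congrArg c'.φ (c.φ.left_inv hj)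
  refine Prod.ext h0 ?_
  ext1 v
  obtain ⟨L, hL⟩ := c'.exists_dψ_equiv (c'.proj_mem _ hj')
  obtain ⟨w, rfl⟩ := L.surjective v
  have h1 := congrArg Prod.snd (dφ_τ c' j hj' w)
  rw [hL]
  refine Eq.trans ?_ h1
  rw [c.dφ_change c' hj hj', dφ_τ c j hj, c'.dψ_change c (c'.proj_mem _ hj') (c.proj_mem _ hj)]
  have h2 : (coord c j).1 = c.φ j.pt := rfl
  simp only [change, ContinuousLinearMap.comp_apply, add_apply,
    ContinuousLinearMap.coe_snd', ContinuousLinearMap.inl_apply, ContinuousLinearMap.inr_apply,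
    h2, h0, c'.fst_eq _ hj']
  simp

theorem contDiffOn_change (c c' : P.AdaptedChart) :
    ContDiffOn ℝ ∞ (change c c') (Prod.fst ⁻¹' c.overlap c') := by
  have hmap : MapsTo (Prod.fst : JetModel n k → _)
      (Prod.fst ⁻¹' c.overlap c') (c.overlap c') := fun z hz => hz
  have h1 := (c.contDiffOn_change c').comp contDiff_fst.contDiffOn hmap
  have h2 := ((c.contDiffOn_change c').fderiv_of_isOpen (c.isOpen_overlap c')
    (m := ∞) (by simp)).comp contDiff_fst.contDiffOn hmap
  have h3 := ((c.contDiffOn_change_base c').fderiv_of_isOpen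
    (c'.ψ.symm.trans c.ψ).open_source (m := ∞) (by simp)).comp (contDiff_fst.comp_contDiffOn h1)
    fun z hz => c.fst_change_mem c' hz
  refine h1.prodMk ?_
  refine contDiffOn_const.clm_comp (h2.clm_comp (ContDiffOn.clm_comp ?_ h3))
  exact contDiffOn_const.add (contDiffOn_const.clm_comp contDiff_snd.contDiffOn)

variable [IsManifold 𝓘(ℝ, EuclideanSpace ℝ (Fin k)) ∞ F]
  [IsManifold 𝓘(ℝ, EuclideanSpace ℝ (Fin n)) ∞ M]

/-- The jet coordinates of all adapted charts. -/
noncomputable def coordinateSystem (P : SmoothFiberBundle n k F E M) :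
    CoordinateSystem P.Jet1 (JetModel n k) where
  ι := P.AdaptedChart
  coord := coord
  dom c := {j | j.pt ∈ c.φ.source}
  injOn := coord_injOn
  cover j := P.exists_adaptedChart j.pt
  isOpen_image c c' := by
    rw [image_overlap]
    exact (c.isOpen_overlap c').preimage continuous_fst
  smooth c c' := ⟨change c c', by rw [image_overlap]; exact contDiffOn_change c c',
    fun j hj => change_coord c c' j hj.1 hj.2⟩

noncomputable instance : TopologicalSpace P.Jet1 := (coordinateSystem P).topology

noncomputable instance : ChartedSpace (JetModel n k) P.Jet1 :=
  (coordinateSystem P).chartedSpace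

instance : IsManifold 𝓘(ℝ, JetModel n k) ∞ P.Jet1 :=
  (coordinateSystem P).isManifold

end Jet1

namespace AdaptedFrame

/-- The frame coordinates `(x^i, y^A, v^i_j, v^A_j, v^A_B)`. -/
noncomputable def coord (c : P.AdaptedChart) (u : P.AdaptedFrame) :
    FrameModel n k :=
  (c.φ u.pt, fun i => c.dφ u.pt (u.frame (Sum.inl i)),
    fun A => (c.dφ u.pt (u.frame (Sum.inr A))).2)

theorem dφ_inr (c : P.AdaptedChart) (u : P.AdaptedFrame) (hu : u.pt ∈ c.φ.source) (A : Fin k) :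
    c.dφ u.pt (u.frame (Sum.inr A)) = (0, (coord c u).2.2 A) := by
  refine Prod.ext ?_ rfl
  rw [c.fst_dφ hu, u.vertical]
  simp

theorem coord_injOn (c : P.AdaptedChart) :
    InjOn (coord c) {u : P.AdaptedFrame | u.pt ∈ c.φ.source} := by
  intro u hu u' hu' h
  have hpt : u.pt = u'.pt := c.φ.injOn hu hu' (congrArg Prod.fst h)
  have h1 := dφ_inr c u hu
  have h2 := dφ_inr c u' hu'
  rw [← h] at h2
  have h3 : ∀ i, c.dφ u.pt (u.frame (Sum.inl i)) = c.dφ u'.pt (u'.frame (Sum.inl i)) :=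
    fun i => congrFun (congrArg (fun z => z.2.1) h) i
  obtain ⟨K, hK⟩ := c.exists_dφ_equiv hu
  generalize (coord c u).2.2 = b at h1 h2
  clear h
  obtain ⟨e, f, hf⟩ := u
  obtain ⟨e', f', hf'⟩ := u'
  obtain rfl : e = e' := hpt
  congr 1
  refine Module.Basis.eq_of_apply_eq fun a => K.injective ?_
  rw [hK, hK]
  rcases a with i | A
  · exact h3 i
  · exact (h1 A).trans (h2 A).symm

/-- The coordinates `(v^i_j, v^A_j, v^A_B)` of frames: the block triangular matrix is invertible. -/
def frameDomain (n k : ℕ) : Set ((Fin n → EuclideanSpace ℝ (Fin n) × EuclideanSpace ℝ (Fin k)) ×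
    (Fin k → EuclideanSpace ℝ (Fin k))) :=
  {z | LinearIndependent ℝ (Sum.elim z.1
    (fun A => ((0 : EuclideanSpace ℝ (Fin n)), z.2 A)))}

theorem isOpen_frameDomain (n k : ℕ) : IsOpen (frameDomain n k) := by
  have h : Continuous fun z : (Fin n → EuclideanSpace ℝ (Fin n) × EuclideanSpace ℝ (Fin k)) ×
      (Fin k → EuclideanSpace ℝ (Fin k)) =>
      (Sum.elim z.1 (fun A => ((0 : EuclideanSpace ℝ (Fin n)), z.2 A))) := by
    refine continuous_pi fun a => ?_
    rcases a with i | A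
    · exact (continuous_apply i).comp continuous_fst
    · exact continuous_const.prodMk ((continuous_apply A).comp continuous_snd)
  exact (isOpen_setOfPred_linearIndependent (𝕜 := ℝ)).preimage h

/-- The frame over `e` with given coordinates `(v^i_j, v^A_j, v^A_B)`. -/
theorem exists_coord (c : P.AdaptedChart) {e : E} (he : e ∈ c.φ.source)
    {z : (Fin n → EuclideanSpace ℝ (Fin n) × EuclideanSpace ℝ (Fin k)) ×
      (Fin k → EuclideanSpace ℝ (Fin k))} (hz : z ∈ frameDomain n k) :
    ∃ u : P.AdaptedFrame, u.pt = e ∧ coord c u = (c.φ e, z) := by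
  obtain ⟨L, hL⟩ := c.exists_dψ_equiv (c.proj_mem _ he)
  obtain ⟨K, hK⟩ := c.exists_dφ_equiv he
  have hspan := LinearIndependent.span_eq_top_of_card_eq_finrank' hz (by simp)
  set b := Module.Basis.mk hz hspan.ge
  have hbi : ∀ i, b (Sum.inl i) = z.1 i := fun i => Module.Basis.mk_apply hz hspan.ge _
  have hbA : ∀ A, b (Sum.inr A) = (0, z.2 A) := fun A => Module.Basis.mk_apply hz hspan.ge _
  refine ⟨⟨e, b.map K.symm.toLinearEquiv, fun A => L.injective ?_⟩, rfl, ?_⟩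
  · rw [hL, ← c.fst_dφ he, ← hK]
    simp [hbA]
  · refine Prod.ext rfl (Prod.ext ?_ ?_)
    · funext i
      simp [coord, ← hK, hbi]
    · funext A
      simp [coord, ← hK, hbA]

theorem coord_mem_frameDomain (c : P.AdaptedChart) (u : P.AdaptedFrame)
    (hu : u.pt ∈ c.φ.source) : (coord c u).2 ∈ frameDomain n k := by
  obtain ⟨K, hK⟩ := c.exists_dφ_equiv hu
  have h := u.frame.linearIndependent.map' K.toLinearEquiv.toLinearMap
    (LinearMap.ker_eq_bot.2 K.injective)
  change LinearIndependent ℝ (Sum.elim _ _)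
  convert! h using 1
  funext a
  rcases a with i | A
  · exact (hK _).symm
  · exact (dφ_inr c u hu A).symm.trans (hK _).symm

theorem image_overlap (c c' : P.AdaptedChart) :
    coord c '' ({u : P.AdaptedFrame | u.pt ∈ c.φ.source} ∩
      {u : P.AdaptedFrame | u.pt ∈ c'.φ.source}) = c.overlap c' ×ˢ frameDomain n k := by
  ext ⟨w, z⟩
  constructor
  · rintro ⟨u, ⟨hu, hu'⟩, h⟩
    have h1 : c.φ u.pt = w := congrArg Prod.fst h
    have h2 := coord_mem_frameDomain c u hu
    rw [h] at h2
    exact ⟨h1 ▸ c.mem_overlap c' hu hu', h2⟩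
  · rintro ⟨h, h'⟩
    obtain ⟨e, he, he', h1⟩ := c.exists_of_mem_overlap c' h
    obtain ⟨u, rfl, hu⟩ := exists_coord c he h'
    exact ⟨u, ⟨he, he'⟩, by rw [hu, h1]⟩

/-- The change of frame coordinates. -/
noncomputable def change (c c' : P.AdaptedChart)
    (z : FrameModel n k) :
    FrameModel n k :=
  ((c'.φ ∘ c.φ.symm) z.1, fun i => fderiv ℝ (c'.φ ∘ c.φ.symm) z.1 (z.2.1 i),
    fun A => (fderiv ℝ (c'.φ ∘ c.φ.symm) z.1 (0, z.2.2 A)).2)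

theorem change_coord (c c' : P.AdaptedChart) (u : P.AdaptedFrame) (hu : u.pt ∈ c.φ.source)
    (hu' : u.pt ∈ c'.φ.source) : change c c' (coord c u) = coord c' u := by
  have h0 : (c'.φ ∘ c.φ.symm) (c.φ u.pt) = c'.φ u.pt := congrArg c'.φ (c.φ.left_inv hu)
  refine Prod.ext h0 (Prod.ext ?_ ?_)
  · funext i
    exact (c.dφ_change c' hu hu' _).symm
  · funext A
    change (fderiv ℝ (c'.φ ∘ c.φ.symm) (c.φ u.pt) (0, (coord c u).2.2 A)).2 = _
    rw [← dφ_inr c u hu, ← c.dφ_change c' hu hu']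
    rfl

theorem contDiffOn_change (c c' : P.AdaptedChart) :
    ContDiffOn ℝ ∞ (change c c') (c.overlap c' ×ˢ frameDomain n k) := by
  have hmap : MapsTo Prod.fst (c.overlap c' ×ˢ frameDomain n k) (c.overlap c') :=
    fun z hz => hz.1
  have h1 := (c.contDiffOn_change c').comp contDiff_fst.contDiffOn hmap
  have h2 := ((c.contDiffOn_change c').fderiv_of_isOpen (c.isOpen_overlap c')
    (m := ∞) (by simp)).comp contDiff_fst.contDiffOn hmap
  refine h1.prodMk (ContDiffOn.prodMk (contDiffOn_pi.2 fun i => ?_) (contDiffOn_pi.2 fun A => ?_))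
  · refine h2.clm_apply (ContDiff.contDiffOn ?_)
    exact (contDiff_apply ℝ _ i).comp (contDiff_fst.comp contDiff_snd)
  · refine contDiff_snd.comp_contDiffOn (h2.clm_apply (ContDiff.contDiffOn ?_))
    exact contDiff_const.prodMk ((contDiff_apply ℝ _ A).comp (contDiff_snd.comp contDiff_snd))

section Structure

variable [IsManifold 𝓘(ℝ, EuclideanSpace ℝ (Fin k)) ∞ F]
  [IsManifold 𝓘(ℝ, EuclideanSpace ℝ (Fin n)) ∞ M]

/-- The frame coordinates of all adapted charts. -/
noncomputable def coordinateSystem (P : SmoothFiberBundle n k F E M) :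
    CoordinateSystem P.AdaptedFrame (FrameModel n k) where
  ι := P.AdaptedChart
  coord := coord
  dom c := {u | u.pt ∈ c.φ.source}
  injOn := coord_injOn
  cover u := P.exists_adaptedChart u.pt
  isOpen_image c c' := by
    rw [image_overlap]
    exact (c.isOpen_overlap c').prod (isOpen_frameDomain n k)
  smooth c c' := ⟨change c c', by rw [image_overlap]; exact contDiffOn_change c c',
    fun u hu => change_coord c c' u hu.1 hu.2⟩

noncomputable instance : TopologicalSpace P.AdaptedFrame := (coordinateSystem P).topology

noncomputable instance : ChartedSpace (FrameModel n k) P.AdaptedFrame :=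
  (coordinateSystem P).chartedSpace

instance : IsManifold 𝓘(ℝ, FrameModel n k) ∞ P.AdaptedFrame :=
  (coordinateSystem P).isManifold

end Structure

end AdaptedFrame

/-! ### The structure group -/

/-- The group `G_V` of nonsingular block lower triangular matrices `(A 0; C B)`. -/
def structureGroup (n k : ℕ) : Subgroup (GL (Fin n ⊕ Fin k) ℝ) where
  carrier := {g | ∀ (i : Fin n) (A : Fin k), g.val (Sum.inl i) (Sum.inr A) = 0}
  one_mem' i A := by simp
  mul_mem' {g h} hg hh i A := by
    have hg' : ∀ (i : Fin n) (A : Fin k), g.val (Sum.inl i) (Sum.inr A) = 0 := hg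
    have hh' : ∀ (i : Fin n) (A : Fin k), h.val (Sum.inl i) (Sum.inr A) = 0 := hh
    change (g.val * h.val) (Sum.inl i) (Sum.inr A) = 0
    simp [Matrix.mul_apply, hg', hh']
  inv_mem' {g} hg i A := by
    have h : Matrix.BlockTriangular g.val
        (Sum.elim (fun _ => 1) (fun _ => 0) : Fin n ⊕ Fin k → ℕ) := by
      rintro (i | A) (j | B) hlt
      · simp at hlt
      · exact hg i B
      · simp at hlt
      · simp at hlt
    have := g.invertible
    have h' := Matrix.blockTriangular_inv_of_blockTriangular h
    change (g⁻¹).val (Sum.inl i) (Sum.inr A) = 0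
    rw [Matrix.coe_units_inv]
    exact h' (by simp)

/-- The matrix of an element of `G_V`. -/
def structureGroup.mat (g : structureGroup n k) : Matrix (Fin n ⊕ Fin k) (Fin n ⊕ Fin k) ℝ :=
  g.1.val

theorem structureGroup.mat_mul_inv (g : structureGroup n k) :
    structureGroup.mat g * structureGroup.mat g⁻¹ = 1 := Units.mul_inv g.1

theorem structureGroup.inv_mul_mat (g : structureGroup n k) :
    structureGroup.mat g⁻¹ * structureGroup.mat g = 1 := Units.inv_mul g.1

/-- The Lie algebra of `G_V`: all block lower triangular matrices. -/
def structureAlgebra (n k : ℕ) : Submodule ℝ (Matrix (Fin n ⊕ Fin k) (Fin n ⊕ Fin k) ℝ) where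
  carrier := {η | ∀ (i : Fin n) (A : Fin k), η (Sum.inl i) (Sum.inr A) = 0}
  zero_mem' i A := rfl
  add_mem' {η ζ} h h' i A := by simp [h i A, h' i A]
  smul_mem' c η h i A := by simp [h i A]

/-- The exponential map of `G_V`. -/
noncomputable def structureExp (η : structureAlgebra n k) : structureGroup n k :=
  ⟨(Matrix.isUnit_exp (η : Matrix (Fin n ⊕ Fin k) (Fin n ⊕ Fin k) ℝ)).unit, by
    have h : Matrix.BlockTriangular (η : Matrix (Fin n ⊕ Fin k) (Fin n ⊕ Fin k) ℝ)
        (Sum.elim (fun _ => 1) (fun _ => 0) : Fin n ⊕ Fin k → ℕ) := by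
      rintro (i | A) (j | B) hlt
      · simp at hlt
      · exact η.2 i B
      · simp at hlt
      · simp at hlt
    exact fun i A => h.exp (by simp)⟩

/-- The element `E^i_B` of the standard basis of matrices: its only nonzero entry, equal to `1`, is
in row `B` of the lower blocks and in column `i`. -/
def structureBasis (i : Fin n) (B : Fin k) : structureAlgebra n k :=
  ⟨Matrix.single (Sum.inr B) (Sum.inl i) 1, fun j A => by simp [Matrix.single]⟩

/-- The element `(I 0; ξ I)` of `G_V`. -/
def unipotent (ξ : Matrix (Fin k) (Fin n) ℝ) : structureGroup n k :=
  ⟨⟨Matrix.fromBlocks 1 0 ξ 1, Matrix.fromBlocks 1 0 (-ξ) 1,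
    by simp [Matrix.fromBlocks_multiply], by simp [Matrix.fromBlocks_multiply]⟩,
    fun i A => by simp⟩

/-- The action of `G_V` on `G_V / H`, `H = GL(n) × GL(k)`, where the coset of `(I 0; ξ I)` is
identified with the matrix `ξ`: `(A 0; C B) · ξ = C A⁻¹ + B ξ A⁻¹`. -/
noncomputable def affineAction (g : structureGroup n k) (ξ : Matrix (Fin k) (Fin n) ℝ) :
    Matrix (Fin k) (Fin n) ℝ :=
  (structureGroup.mat g).toBlocks₂₁ *
      (structureGroup.mat g).toBlocks₁₁⁻¹ +
    (structureGroup.mat g).toBlocks₂₂ * ξ *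
      (structureGroup.mat g).toBlocks₁₁⁻¹

theorem affineAction_mul (g : structureGroup n k) (ξ : Matrix (Fin k) (Fin n) ℝ) :
    affineAction g ξ * (structureGroup.mat g).toBlocks₁₁ =
      (structureGroup.mat g).toBlocks₂₁ +
        (structureGroup.mat g).toBlocks₂₂ * ξ := by
  have h0 : (structureGroup.mat g).toBlocks₁₂ = 0 := by
    ext i A; exact g.2 i A
  have h1 : IsUnit (structureGroup.mat g).det :=
    (Matrix.isUnit_iff_isUnit_det _).1 (Units.isUnit _)
  rw [← Matrix.fromBlocks_toBlocks (structureGroup.mat g), h0,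
    Matrix.det_fromBlocks_zero₁₂] at h1
  have h2 := isUnit_of_mul_isUnit_left h1
  rw [affineAction, Matrix.add_mul, Matrix.mul_assoc, Matrix.mul_assoc, Matrix.nonsing_inv_mul _ h2,
    Matrix.mul_one, Matrix.mul_one]

/-! ### Structures on the adapted frame bundle -/

namespace AdaptedFrame

/-- The right action of `G_V` on frames: `(u · g)_b = g^a_b u_a`. -/
noncomputable def act (u : P.AdaptedFrame) (g : structureGroup n k) : P.AdaptedFrame where
  pt := u.pt
  frame := u.frame.map (Matrix.toLinOfInv u.frame u.frame
    (M := structureGroup.mat g)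
    (M' := structureGroup.mat g⁻¹) (structureGroup.mat_mul_inv g) (structureGroup.inv_mul_mat g))
  vertical A := by
    have h : ∀ i : Fin n, structureGroup.mat g (Sum.inl i) (Sum.inr A) = 0 :=
      fun i => g.2 i A
    change P.dproj u.pt (Matrix.toLin u.frame u.frame (structureGroup.mat g)
      (u.frame (Sum.inr A))) = 0
    rw [Matrix.toLin_self, map_sum, Fintype.sum_sum_type]
    simp [u.vertical, h]

theorem act_frame (u : P.AdaptedFrame) (g : structureGroup n k) (b : Fin n ⊕ Fin k) :
    (u.act g).frame b =
      ∑ a, structureGroup.mat g a b • u.frame a := by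
  rw [← Matrix.toLin_self u.frame u.frame]
  rfl

variable [IsManifold 𝓘(ℝ, EuclideanSpace ℝ (Fin k)) ∞ F]
  [IsManifold 𝓘(ℝ, EuclideanSpace ℝ (Fin n)) ∞ M]

/-- The fundamental vertical vector field `η*` on `L_π E`, `η*(u) = d/dt (u · exp(tη))|_{t=0}`. -/
noncomputable def fundamentalField (η : structureAlgebra n k) (u : P.AdaptedFrame) :
    TangentSpace 𝓘(ℝ, FrameModel n k) u :=
  mfderiv 𝓘(ℝ, ℝ) 𝓘(ℝ, FrameModel n k) (fun t : ℝ => u.act (structureExp (t • η))) 0 (1 : ℝ)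

/-- The tangent map `λ_*(u) : T_u(L_π E) → T_e E` of the projection `λ`. -/
noncomputable def dpt (u : P.AdaptedFrame) :
    TangentSpace 𝓘(ℝ, FrameModel n k) u →L[ℝ] TSp (n + k) u.pt :=
  mfderiv 𝓘(ℝ, FrameModel n k) 𝓘(ℝ, EuclideanSpace ℝ (Fin (n + k))) AdaptedFrame.pt u

/-- The components `θ^i`, `θ^A` of the soldering form of `L_π E`. -/
noncomputable def soldering (a : Fin n ⊕ Fin k) (u : P.AdaptedFrame)
    (X : TangentSpace 𝓘(ℝ, FrameModel n k) u) : ℝ :=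
  u.frame.coord a (u.dpt X)

/-- The tensor field `E^{*i}_B ⊗ θ^B` (sum over `B`) on `L_π E`. -/
noncomputable def tangentTensor (i : Fin n) (u : P.AdaptedFrame)
    (X : TangentSpace 𝓘(ℝ, FrameModel n k) u) : TangentSpace 𝓘(ℝ, FrameModel n k) u :=
  ∑ B : Fin k, soldering (Sum.inr B) u X • fundamentalField (structureBasis i B) u

theorem span_baseFrame (u : P.AdaptedFrame) :
    ⊤ ≤ Submodule.span ℝ (range fun i : Fin n => P.dproj u.pt (u.frame (Sum.inl i))) := by
  intro w _
  obtain ⟨v, rfl⟩ := P.dproj_surjective u.pt w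
  rw [← u.frame.sum_repr v, map_sum, Fintype.sum_sum_type]
  simp only [map_smul, u.vertical, smul_zero, Finset.sum_const_zero, add_zero]
  exact Submodule.sum_mem _ fun i _ => Submodule.smul_mem _ _ (Submodule.subset_span ⟨i, rfl⟩)

/-- The basis `ê_i = π_*(e)(e_i)` of `T_{π(e)} M`. -/
noncomputable def baseFrame (u : P.AdaptedFrame) : Module.Basis (Fin n) ℝ (TSp n (P.proj u.pt)) :=
  Module.Basis.mk
    (linearIndependent_of_top_le_span_of_card_eq_finrank u.span_baseFrame
      ((Fintype.card_fin n).trans (finrank_euclideanSpace_fin (𝕜 := ℝ)).symm))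
    u.span_baseFrame

theorem baseFrame_apply (u : P.AdaptedFrame) (i : Fin n) :
    u.baseFrame i = P.dproj u.pt (u.frame (Sum.inl i)) :=
  Module.Basis.mk_apply _ _ _

/-- The linear map `T_{π(e)} M → T_e E` that takes `ê_i` to `e_i + ξ^A_i e_A`. -/
noncomputable def lift (u : P.AdaptedFrame) (ξ : Matrix (Fin k) (Fin n) ℝ) :
    TSp n (P.proj u.pt) →ₗ[ℝ] TSp (n + k) u.pt :=
  u.baseFrame.constr ℝ fun i => u.frame (Sum.inl i) + ∑ A, ξ A i • u.frame (Sum.inr A)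

theorem lift_apply (u : P.AdaptedFrame) (ξ : Matrix (Fin k) (Fin n) ℝ) (i : Fin n) :
    u.lift ξ (P.dproj u.pt (u.frame (Sum.inl i))) =
      u.frame (Sum.inl i) + ∑ A, ξ A i • u.frame (Sum.inr A) := by
  rw [← baseFrame_apply, lift, Module.Basis.constr_basis]

theorem continuous_lift (u : P.AdaptedFrame) (ξ : Matrix (Fin k) (Fin n) ℝ) :
    Continuous (u.lift ξ) := by
  have : FiniteDimensional ℝ (TSp n (P.proj u.pt)) :=
    inferInstanceAs (FiniteDimensional ℝ (EuclideanSpace ℝ (Fin n)))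
  have : T2Space (TSp n (P.proj u.pt)) := inferInstanceAs (T2Space (EuclideanSpace ℝ (Fin n)))
  exact LinearMap.continuous_of_finiteDimensional (u.lift ξ)

/-- The jet given by a frame `u = (e_i, e_A)_e` and a matrix `ξ`: the map `ê_i ↦ e_i + ξ^A_i e_A`. -/
noncomputable def jet (u : P.AdaptedFrame) (ξ : Matrix (Fin k) (Fin n) ℝ) : P.Jet1 where
  pt := u.pt
  τ := ⟨u.lift ξ, u.continuous_lift ξ⟩
  right_inv w := by
    have h : (P.dproj u.pt).toLinearMap ∘ₗ u.lift ξ = LinearMap.id := by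
      refine u.baseFrame.ext fun i => ?_
      rw [baseFrame_apply, LinearMap.comp_apply, lift_apply]
      simp [u.vertical]
    exact congrArg (fun f => f w) h

/-- The projection `ρ : L_π E → J¹π`: `ρ(e_i, e_A)_e` is the map `ê_i ↦ e_i`. -/
noncomputable def toJet (u : P.AdaptedFrame) : P.Jet1 := u.jet 0

theorem sum_aux {V : Type*} [AddCommGroup V] [Module ℝ V] (e : Fin n → V) (f : Fin k → V)
    (a : Fin n → ℝ) (c : Fin k → ℝ) (b : Fin k → Fin k → ℝ) (x : Fin k → ℝ)
    (ζ : Fin k → Fin n → ℝ) (h : ∀ A, ∑ i, ζ A i * a i = c A + ∑ B, b A B * x B) :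
    (∑ i, a i • e i + ∑ A, c A • f A) + ∑ B, x B • ∑ A, b A B • f A =
      ∑ i, a i • (e i + ∑ A, ζ A i • f A) := by
  simp only [smul_add, Finset.sum_add_distrib, Finset.smul_sum, smul_smul]
  rw [add_assoc, Finset.sum_comm (f := fun B A => (x B * b A B) • f A),
    Finset.sum_comm (f := fun i A => (a i * ζ A i) • f A), ← Finset.sum_add_distrib]
  congr 1
  refine Finset.sum_congr rfl fun A _ => ?_
  rw [← Finset.sum_smul, ← Finset.sum_smul, ← add_smul]
  congr 1
  rw [Finset.sum_congr rfl fun i _ => mul_comm (a i) (ζ A i), h A]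
  exact congrArg _ (Finset.sum_congr rfl fun B _ => mul_comm _ _)

theorem jet_act (u : P.AdaptedFrame) (g : structureGroup n k) (ξ : Matrix (Fin k) (Fin n) ℝ) :
    (u.act g).jet ξ = u.jet (affineAction g ξ) := by
  have h : (u.act g).lift ξ = u.lift (affineAction g ξ) := by
    refine (u.act g).baseFrame.ext fun j => ?_
    have hg := affineAction_mul g ξ
    have h12 : ∀ (i : Fin n) (A : Fin k),
        structureGroup.mat g (Sum.inl i) (Sum.inr A) = 0 := g.2
    generalize affineAction g ξ = ζ at hg
    have hg' : ∀ A, ∑ i, ζ A i * structureGroup.mat g (Sum.inl i) (Sum.inl j)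
        = structureGroup.mat g (Sum.inr A) (Sum.inl j) +
          ∑ B, structureGroup.mat g (Sum.inr A) (Sum.inr B) * ξ B j := by
      intro A
      have := congrFun (congrFun hg A) j
      simpa [Matrix.mul_apply, Matrix.toBlocks₁₁, Matrix.toBlocks₂₁, Matrix.toBlocks₂₂] using this
    have h1 : (u.act g).frame (Sum.inl j) =
        ∑ i, structureGroup.mat g (Sum.inl i) (Sum.inl j) • u.frame (Sum.inl i) +
          ∑ A, structureGroup.mat g (Sum.inr A) (Sum.inl j) • u.frame (Sum.inr A) :=
      (u.act_frame g _).trans (Fintype.sum_sum_type _)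
    have h2 : ∀ B, (u.act g).frame (Sum.inr B) =
        ∑ A, structureGroup.mat g (Sum.inr A) (Sum.inr B) • u.frame (Sum.inr A) := by
      intro B
      refine ((u.act_frame g _).trans (Fintype.sum_sum_type _)).trans ?_
      simp only [h12, zero_smul]
      exact (congrArg (· + _) Finset.sum_const_zero).trans (zero_add _)
    have h3 : P.dproj u.pt ((u.act g).frame (Sum.inl j)) =
        ∑ i, structureGroup.mat g (Sum.inl i) (Sum.inl j) •
            P.dproj u.pt (u.frame (Sum.inl i)) := by
      refine (congrArg (P.dproj u.pt) h1).trans ?_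
      simp [u.vertical]
    have h4 : u.lift ζ (P.dproj u.pt ((u.act g).frame (Sum.inl j))) =
        ∑ i, structureGroup.mat g (Sum.inl i) (Sum.inl j) •
          (u.frame (Sum.inl i) + ∑ A, ζ A i • u.frame (Sum.inr A)) := by
      refine (congrArg (u.lift ζ) h3).trans ?_
      simp [lift_apply]
    have h5 : ∑ B, ξ B j • (u.act g).frame (Sum.inr B) =
        ∑ B, ξ B j • ∑ A, structureGroup.mat g (Sum.inr A) (Sum.inr B) • u.frame (Sum.inr A) :=
      Finset.sum_congr rfl fun B _ => congrArg _ (h2 B)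
    rw [baseFrame_apply]
    refine ((u.act g).lift_apply ξ j).trans (Eq.trans ?_ h4.symm)
    refine (congrArg₂ (· + ·) h1 h5).trans ?_
    exact sum_aux _ _ _ _ (fun A B => structureGroup.mat g (Sum.inr A) (Sum.inr B))
      (fun B => ξ B j) ζ hg'
  have h' : (⟨(u.act g).lift ξ, (u.act g).continuous_lift ξ⟩ :
      TSp n (P.proj u.pt) →L[ℝ] TSp (n + k) u.pt) =
        ⟨u.lift (affineAction g ξ), u.continuous_lift _⟩ :=
    ContinuousLinearMap.coe_injective h
  change Jet1.mk u.pt ⟨(u.act g).lift ξ, (u.act g).continuous_lift ξ⟩ _ =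
    Jet1.mk u.pt ⟨u.lift (affineAction g ξ), u.continuous_lift _⟩ _
  congr 1

end AdaptedFrame

/-- The relation `(u · g, ξ) ∼ (u, g · ξ)`, `g ∈ G_V`, on `L_π E × (G_V / H)`. -/
def associatedRel (P : SmoothFiberBundle n k F E M)
    (p q : P.AdaptedFrame × Matrix (Fin k) (Fin n) ℝ) : Prop :=
  ∃ g : structureGroup n k, p.1 = q.1.act g ∧ affineAction g p.2 = q.2

/-- The associated bundle `L_π E ×_{G_V} (G_V / H)`. -/
def AssociatedBundle (P : SmoothFiberBundle n k F E M) : Type _ :=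
  Quot P.associatedRel

/-- The class `[u, ξ]`. -/
def jetClass (u : P.AdaptedFrame) (ξ : Matrix (Fin k) (Fin n) ℝ) : P.AssociatedBundle :=
  Quot.mk _ (u, ξ)

/-! ### Structures on the first jet bundle -/

/-- The vertical tangent space `V_e π`. -/
noncomputable def vertical (P : SmoothFiberBundle n k F E M) (e : E) :
    Submodule ℝ (TSp (n + k) e) :=
  LinearMap.ker (P.dproj e).toLinearMap

section Structures

variable [IsManifold 𝓘(ℝ, EuclideanSpace ℝ (Fin k)) ∞ F]
  [IsManifold 𝓘(ℝ, EuclideanSpace ℝ (Fin n)) ∞ M]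

/-- The identification of `L_π E ×_{G_V} (G_V / H)` with `J¹π`: the class `[(e_i, e_A)_e, ξ]` is the
map `ê_i ↦ e_i + ξ^A_i e_A`. -/
noncomputable def AssociatedBundle.toJet : P.AssociatedBundle → P.Jet1 :=
  Quot.lift (fun p => p.1.jet p.2) (by
    rintro ⟨v, ξ⟩ ⟨u, ζ⟩ ⟨g, h, h'⟩
    obtain rfl : v = u.act g := h
    obtain rfl : affineAction g ξ = ζ := h'
    exact u.jet_act g ξ)

namespace Jet1

/-- The tangent map `(π_{1,0})_*(j) : T_j(J¹π) → T_e E`. -/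
noncomputable def dpt (j : P.Jet1) :
    TangentSpace 𝓘(ℝ, JetModel n k) j →L[ℝ] TSp (n + k) j.pt :=
  mfderiv 𝓘(ℝ, JetModel n k) 𝓘(ℝ, EuclideanSpace ℝ (Fin (n + k))) Jet1.pt j

/-- The vertical differential `v ↦ v - (φ ∘ π)_* v` of a section `φ` with jet `j`; here
`φ_* = j.τ`. -/
noncomputable def verticalDifferential (j : P.Jet1) (v : TSp (n + k) j.pt) : P.vertical j.pt :=
  ⟨v - j.τ (P.dproj j.pt v), by
    change P.dproj j.pt (v - j.τ (P.dproj j.pt v)) = 0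
    rw [map_sub, j.right_inv, sub_self]⟩

/-- The canonical contact form `ω¹` on `J¹π`, with values in `Vπ`. -/
noncomputable def contactForm (j : P.Jet1) (X : TangentSpace 𝓘(ℝ, JetModel n k) j) :
    P.vertical j.pt :=
  j.verticalDifferential (j.dpt X)

/-- The jet `τ + t η ⊗ ζ`, for a covector `η` of `M` and a vertical vector `ζ`. -/
noncomputable def translate (j : P.Jet1) (η : TSp n (P.proj j.pt) →L[ℝ] ℝ) (ζ : P.vertical j.pt)
    (t : ℝ) : P.Jet1 where
  pt := j.pt
  τ := j.τ + t • η.smulRight (ζ : TSp (n + k) j.pt)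
  right_inv w := by
    have h : P.dproj j.pt (ζ : TSp (n + k) j.pt) = 0 := ζ.2
    simp [j.right_inv, h]

/-- The vertical lift `η ⊙_j ζ = d/dt (τ + t η ⊗ ζ)|_{t=0}`, with coordinates
`η_i ζ^A ∂/∂y^A_i`. -/
noncomputable def verticalLift (j : P.Jet1) (η : TSp n (P.proj j.pt) →L[ℝ] ℝ)
    (ζ : P.vertical j.pt) : TangentSpace 𝓘(ℝ, JetModel n k) j :=
  mfderiv 𝓘(ℝ, ℝ) 𝓘(ℝ, JetModel n k) (j.translate η ζ) 0 (1 : ℝ)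

/-- The vertical endomorphism `S_α` on `J¹π`, `S_α(j)(X) = α ⊙_j ω¹(X)`. -/
noncomputable def verticalEndomorphism (α : ∀ x : M, TSp n x →L[ℝ] ℝ) (j : P.Jet1)
    (X : TangentSpace 𝓘(ℝ, JetModel n k) j) : TangentSpace 𝓘(ℝ, JetModel n k) j :=
  j.verticalLift (α (P.proj j.pt)) (j.contactForm X)

end Jet1

namespace AdaptedFrame

/-- The tangent map `ρ_*(u)`. -/
noncomputable def dtoJet (u : P.AdaptedFrame) :
    TangentSpace 𝓘(ℝ, FrameModel n k) u →L[ℝ] TangentSpace 𝓘(ℝ, JetModel n k) u.toJet :=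
  mfderiv 𝓘(ℝ, FrameModel n k) 𝓘(ℝ, JetModel n k) AdaptedFrame.toJet u

/-- The pull-back `π^* α`. -/
noncomputable def pullback (P : SmoothFiberBundle n k F E M) (α : ∀ x : M, TSp n x →L[ℝ] ℝ) (e : E) :
    TSp (n + k) e →L[ℝ] ℝ :=
  (α (P.proj e)).comp (P.dproj e)

/-- The vector `ρ_*(u·ξ) ((π^*α)_e(e_i) (E^{*i}_B ⊗ θ^B)(u·ξ)(X))` at the point `ρ(u·ξ)`, where
`u = (e_i, e_A)_e` and `u·ξ = u (I 0; ξ I)`. -/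
noncomputable def pushedTensor (α : ∀ x : M, TSp n x →L[ℝ] ℝ) (u : P.AdaptedFrame)
    (ξ : Matrix (Fin k) (Fin n) ℝ)
    (X : TangentSpace 𝓘(ℝ, FrameModel n k) (u.act (unipotent ξ))) :
    TangentSpace 𝓘(ℝ, JetModel n k) (u.act (unipotent ξ)).toJet :=
  (u.act (unipotent ξ)).dtoJet
    (∑ i : Fin n, pullback P α u.pt (u.frame (Sum.inl i)) •
      tangentTensor i (u.act (unipotent ξ)) X)

end AdaptedFrame

end Structures

end SmoothFiberBundle

end Jets

open SmoothFiberBundle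

/-! Everything rests on one identity, for an arbitrary adapted frame `w = (e_i, e_A)` with `ê_i =
π_*(e_i)` and dual basis `ê^i`. Since `E^i_B` squares to zero, `exp(tE^i_B) = I + tE^i_B`, so the
curve `w · exp(tE^i_B)` replaces `e_i` by `e_i + t e_B` and leaves the other vectors alone. Its
image under `ρ` is the affine curve `ρ(w) + t ê^i ⊗ e_B`. Hence `ρ_*` takes `E^{*i}_B` to the
vertical lift `ê^i ⊙ e_B` (`dtoJet_fundamentalField`).

On the other side, `v - ρ(w)(π_* v)` is the projection of `v` onto the span of the `e_B` along the
`e_i`, so for `v = λ_* X` it equals the sum of the `θ^B(X) e_B`; and `α` is the sum of the `α(ê_i)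
ê^i`. Bilinearity of the vertical lift then identifies the pushed tensor with `α ⊙ (v - ρ(w)(π_*
v))` (`dtoJet_sum`).

For `w = u·ξ` the vectors `ê_i` are those of `u`, and `ρ(u·ξ) = [u, ξ]` (`pushedTensor_eq`,
`toJet_act_unipotent`). The resulting expression involves only the jet and the vector projected to
`E`. If that vector comes from `J¹π` it is `S_α`, which gives the formula; independence of the
representative is then immediate (`mk_verticalLift_congr`).

The analytic work is to show that `ρ` and the curves are differentiable, since `mfderiv` is zero
otherwise. In adapted coordinates the curves are affine and `ρ` is a matrix quotient. -/

/-! ### Velocities of curves, and linear algebra -/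

/-- A map from a normed space into a manifold is differentiable if its expression in the preferred
chart at the image point is. -/
theorem HasFDerivAt.hasMFDerivAt_of_chartAt {G H N : Type*} [NormedAddCommGroup G]
    [NormedSpace ℝ G] [NormedAddCommGroup H] [NormedSpace ℝ H] [TopologicalSpace N]
    [ChartedSpace H N] {f : G → N} {t : G} {f' : G →L[ℝ] H}
    (h : HasFDerivAt (chartAt H (f t) ∘ f) f' t)
    (hs : ∀ᶠ s in 𝓝 t, f s ∈ (chartAt H (f t)).source) :
    HasMFDerivAt 𝓘(ℝ, G) 𝓘(ℝ, H) f t f' := by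
  refine ⟨?_, ?_⟩
  -- Continuity is part of `HasMFDerivAt`. It follows from the chart expression because `f` is, near
  -- `t`, the inverse chart composed with that expression.
  · have h1 : ContinuousAt ((chartAt H (f t)).symm ∘ (chartAt H (f t) ∘ f)) t :=
      ContinuousAt.comp ((chartAt H (f t)).continuousAt_symm
        ((chartAt H (f t)).map_source (mem_chart_source H (f t)))) h.continuousAt
    refine h1.congr ?_
    filter_upwards [hs] with s hs
    exact (chartAt H (f t)).left_inv hs
  · change HasFDerivWithinAt (chartAt H (f t) ∘ f) f' (range id) t
    exact h.hasFDerivWithinAt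

/-- The tangent map of `ρ` takes the velocity of a curve `γ` to the velocity of `ρ ∘ γ`. -/
theorem mfderiv_mfderiv_curve {H H' N N' : Type*} [NormedAddCommGroup H] [NormedSpace ℝ H]
    [NormedAddCommGroup H'] [NormedSpace ℝ H'] [TopologicalSpace N] [ChartedSpace H N]
    [TopologicalSpace N'] [ChartedSpace H' N'] {γ : ℝ → N} {ρ : N → N'} {δ : ℝ → N'} {x : N}
    (hx : γ 0 = x) (hγ : MDifferentiableAt 𝓘(ℝ, ℝ) 𝓘(ℝ, H) γ 0)
    (hρ : MDifferentiableAt 𝓘(ℝ, H) 𝓘(ℝ, H') ρ x) (hδ : ρ ∘ γ = δ) :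
    (mfderiv 𝓘(ℝ, H) 𝓘(ℝ, H') ρ x (mfderiv 𝓘(ℝ, ℝ) 𝓘(ℝ, H) γ 0 (1 : ℝ) : H) : H') =
      (mfderiv 𝓘(ℝ, ℝ) 𝓘(ℝ, H') δ 0 (1 : ℝ) : H') := by
  -- In the applications the base points agree only propositionally; the ascriptions to `H` and `H'`
  -- allow the comparison, and substitution reduces it to the chain rule.
  subst hx hδ
  exact (mfderiv_comp_apply (0 : ℝ) hρ hγ (1 : ℝ)).symm

/-- A linear map that fixes the first vectors of a basis and kills the others is the projection
along the others. -/
theorem Module.Basis.sub_apply_eq_sum_inr {n k : ℕ} {V : Type*} [AddCommGroup V] [Module ℝ V]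
    (b : Module.Basis (Fin n ⊕ Fin k) ℝ V) (D : V →ₗ[ℝ] V)
    (h : ∀ i, D (b (Sum.inl i)) = b (Sum.inl i)) (h' : ∀ A, D (b (Sum.inr A)) = 0) (v : V) :
    v - D v = ∑ B, b.coord (Sum.inr B) v • b (Sum.inr B) := by
  have hv := b.sum_repr v
  rw [Fintype.sum_sum_type] at hv
  conv_lhs => rw [← hv]
  simp [h, h']

/-- Bilinearity of `η ⊗ ζ`, in the form in which the expansion of `α` in the dual basis meets the
expansion of the contact form in the vertical frame. -/
theorem ContinuousLinearMap.sum_smulRight_sum {n k : ℕ} {V W : Type*} [AddCommGroup V]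
    [Module ℝ V] [TopologicalSpace V] [IsTopologicalAddGroup V] [ContinuousSMul ℝ V]
    [AddCommGroup W] [Module ℝ W] [TopologicalSpace W] [IsTopologicalAddGroup W]
    [ContinuousSMul ℝ W] (a : Fin n → ℝ) (η : Fin n → V →L[ℝ] ℝ) (b : Fin k → ℝ) (e : Fin k → W) :
    (∑ i, a i • η i).smulRight (∑ B, b B • e B) =
      ∑ i, ∑ B, a i • b B • (η i).smulRight (e B) := by
  ext1 w
  simp only [smulRight_apply, sum_apply, smul_apply, smul_eq_mul, Finset.sum_mul, Finset.sum_smul,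
    Finset.smul_sum, smul_smul]
  rw [Finset.sum_comm]
  refine Finset.sum_congr rfl fun i _ => Finset.sum_congr rfl fun B _ => ?_
  congr 1
  ring

namespace SmoothFiberBundle

variable {n k : ℕ} {F E M : Type*}
  [TopologicalSpace F] [ChartedSpace (EuclideanSpace ℝ (Fin k)) F]
  [TopologicalSpace E] [ChartedSpace (EuclideanSpace ℝ (Fin (n + k))) E]
  [TopologicalSpace M] [ChartedSpace (EuclideanSpace ℝ (Fin n)) M]
  {P : SmoothFiberBundle n k F E M}

/-! ### Unipotent elements of the structure group -/

theorem structureGroup.mat_unipotent (ξ : Matrix (Fin k) (Fin n) ℝ) :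
    structureGroup.mat (unipotent ξ) = Matrix.fromBlocks 1 0 ξ 1 := rfl

theorem affineAction_unipotent_zero (ξ : Matrix (Fin k) (Fin n) ℝ) :
    affineAction (unipotent ξ) 0 = ξ := by
  simp [affineAction, structureGroup.mat_unipotent]

/-- The row index of `E^i_B` lies in the fibre block and its column index in the base block, so its
square is zero and the exponential series stops after the linear term. -/
theorem structureExp_smul_structureBasis (i : Fin n) (B : Fin k) (t : ℝ) :
    structureExp (t • structureBasis i B) = unipotent (t • Matrix.single B i 1) := by
  refine Subtype.ext (Units.ext ?_)
  change NormedSpace.exp (t • (Matrix.single (Sum.inr B) (Sum.inl i) (1 : ℝ))) =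
    Matrix.fromBlocks 1 0 (t • Matrix.single B i 1) 1
  have h2 : (t • (Matrix.single (Sum.inr B) (Sum.inl i) (1 : ℝ)) :
      Matrix (Fin n ⊕ Fin k) (Fin n ⊕ Fin k) ℝ) ^ 2 = 0 := by
    simp [pow_two]
  have h3 : NormedSpace.exp (t • (Matrix.single (Sum.inr B) (Sum.inl i) (1 : ℝ)) :
      Matrix (Fin n ⊕ Fin k) (Fin n ⊕ Fin k) ℝ) = 1 +
        t • (Matrix.single (Sum.inr B) (Sum.inl i) (1 : ℝ)) := by
    refine (congrFun (NormedSpace.exp_eq_tsum ℝ) _).trans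
      ((tsum_eq_sum (s := Finset.range 2) ?_).trans ?_)
    rotate_left
    · simp [Finset.sum_range_succ]
    · intro m hm
      have hm' : 2 ≤ m := by simpa [Nat.succ_le_iff] using hm
      rw [pow_eq_zero_of_le hm' h2, smul_zero]
  rw [h3]
  ext (a | a) (b | b) <;> simp [Matrix.single, Matrix.one_apply]

theorem sum_fromBlocks_inl {V : Type*} [AddCommGroup V] [Module ℝ V] (f : Fin n ⊕ Fin k → V)
    (ξ : Matrix (Fin k) (Fin n) ℝ) (i : Fin n) :
    ∑ a, (Matrix.fromBlocks 1 0 ξ 1 : Matrix (Fin n ⊕ Fin k) (Fin n ⊕ Fin k) ℝ)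
      a (Sum.inl i) • f a =
      f (Sum.inl i) + ∑ A, ξ A i • f (Sum.inr A) := by
  simp [Matrix.one_apply]

theorem sum_fromBlocks_inr {V : Type*} [AddCommGroup V] [Module ℝ V] (f : Fin n ⊕ Fin k → V)
    (ξ : Matrix (Fin k) (Fin n) ℝ) (A : Fin k) :
    ∑ a, (Matrix.fromBlocks 1 0 ξ 1 : Matrix (Fin n ⊕ Fin k) (Fin n ⊕ Fin k) ℝ)
      a (Sum.inr A) • f a =
      f (Sum.inr A) := by
  simp [Matrix.one_apply]

namespace AdaptedFrame

theorem act_unipotent_frame_inl (u : P.AdaptedFrame) (ξ : Matrix (Fin k) (Fin n) ℝ) (i : Fin n) :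
    (u.act (unipotent ξ)).frame (Sum.inl i) =
      u.frame (Sum.inl i) + ∑ A, ξ A i • u.frame (Sum.inr A) :=
  (u.act_frame _ _).trans (sum_fromBlocks_inl _ ξ i)

theorem act_unipotent_frame_inr (u : P.AdaptedFrame) (ξ : Matrix (Fin k) (Fin n) ℝ) (A : Fin k) :
    (u.act (unipotent ξ)).frame (Sum.inr A) = u.frame (Sum.inr A) :=
  (u.act_frame _ _).trans (sum_fromBlocks_inr _ ξ A)

theorem act_unipotent_zero (u : P.AdaptedFrame) :
    u.act (unipotent (0 : Matrix (Fin k) (Fin n) ℝ)) = u := by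
  have h : (u.act (unipotent (0 : Matrix (Fin k) (Fin n) ℝ))).frame = u.frame := by
    refine Module.Basis.eq_of_apply_eq fun a => ?_
    rcases a with i | A
    · exact (u.act_unipotent_frame_inl 0 i).trans (by simp; rfl)
    · exact u.act_unipotent_frame_inr 0 A
  change AdaptedFrame.mk u.pt (u.act (unipotent 0)).frame _ = AdaptedFrame.mk u.pt u.frame _
  congr 1

/-- The vectors added to `e_i` are vertical. Hence the coefficients `(π^*α)(e_i)`, which the
statement takes on `u`, may be taken on `u·ξ`. -/
theorem dproj_act_unipotent (u : P.AdaptedFrame) (ξ : Matrix (Fin k) (Fin n) ℝ) (i : Fin n) :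
    P.dproj u.pt ((u.act (unipotent ξ)).frame (Sum.inl i)) =
      P.dproj u.pt (u.frame (Sum.inl i)) := by
  refine (congrArg (P.dproj u.pt) (u.act_unipotent_frame_inl ξ i)).trans ?_
  simp [u.vertical]

end AdaptedFrame

variable [IsManifold 𝓘(ℝ, EuclideanSpace ℝ (Fin k)) ∞ F]
  [IsManifold 𝓘(ℝ, EuclideanSpace ℝ (Fin n)) ∞ M]

/-! ### Preferred charts of the two bundles -/

/-- The adapted chart around `e` that gives the preferred charts of `J¹π` and `L_π E` over `e`. -/
noncomputable def preferredChart (P : SmoothFiberBundle n k F E M) (e : E) : P.AdaptedChart :=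
  (P.exists_adaptedChart e).choose

theorem mem_preferredChart (P : SmoothFiberBundle n k F E M) (e : E) :
    e ∈ (P.preferredChart e).φ.source :=
  (P.exists_adaptedChart e).choose_spec

/-- True by definition, since both sides choose from `exists_adaptedChart` at the base point. The
coordinate map therefore depends only on the base point and is constant along curves in a fibre. -/
theorem Jet1.chartAt_coe (j : P.Jet1) :
    ⇑(chartAt (JetModel n k) j) = Jet1.coord (P.preferredChart j.pt) := rfl

theorem AdaptedFrame.chartAt_coe (u : P.AdaptedFrame) :
    ⇑(chartAt (FrameModel n k) u) = AdaptedFrame.coord (P.preferredChart u.pt) := rfl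

/-! ### The vertical lift in jet coordinates -/

namespace Jet1

/-- The jet coordinates of a linear map `T_{π(e)} M → T_e E`. -/
noncomputable def coordLinear (c : P.AdaptedChart) (e : E) :
    (TSp n (P.proj e) →L[ℝ] TSp (n + k) e) →ₗ[ℝ]
      (EuclideanSpace ℝ (Fin n) →L[ℝ] EuclideanSpace ℝ (Fin k)) where
  toFun σ := ContinuousLinearMap.snd ℝ (EuclideanSpace ℝ (Fin n)) (EuclideanSpace ℝ (Fin k)) ∘L
    c.dφ e ∘L σ ∘L (c.dψ (P.proj e)).inverse
  map_add' σ σ' := by ext1 v; simp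
  map_smul' a σ := by ext1 v; simp

/-- The vertical lift in the preferred chart. -/
theorem hasMFDerivAt_translate (j : P.Jet1) (η : TSp n (P.proj j.pt) →L[ℝ] ℝ)
    (ζ : P.vertical j.pt) :
    HasMFDerivAt 𝓘(ℝ, ℝ) 𝓘(ℝ, JetModel n k) (j.translate η ζ) 0
      ((ContinuousLinearMap.id ℝ ℝ).smulRight ((0, coordLinear (P.preferredChart j.pt) j.pt
        (η.smulRight (ζ : TSp (n + k) j.pt))) : JetModel n k)) := by
  refine HasFDerivAt.hasMFDerivAt_of_chartAt ?_ (.of_forall fun t => P.mem_preferredChart j.pt)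
  -- The base point is fixed and the coordinates `y^A_i` depend linearly on `τ`, so the curve is
  -- affine in `t`.
  have h : chartAt (JetModel n k) (j.translate η ζ 0) ∘ j.translate η ζ = fun t : ℝ =>
      coord (P.preferredChart j.pt) j + t • ((0, coordLinear (P.preferredChart j.pt) j.pt
        (η.smulRight (ζ : TSp (n + k) j.pt))) : JetModel n k) := by
    funext t
    refine Prod.ext (by simp [chartAt_coe, coord, translate]) ?_
    change coordLinear (P.preferredChart j.pt) j.pt (j.τ + t • η.smulRight (ζ : TSp (n + k) j.pt))
      = _
    rw [map_add, map_smul]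
    rfl
  rw [h]
  exact ((hasFDerivAt_id (𝕜 := ℝ) (0 : ℝ)).smul_const ((0, coordLinear (P.preferredChart j.pt) j.pt
    (η.smulRight (ζ : TSp (n + k) j.pt))) : JetModel n k)).const_add
      (coord (P.preferredChart j.pt) j)

/-- This factors the vertical lift through the tensor `η ⊗ ζ` and a linear map, which is what makes
its bilinearity usable. -/
theorem verticalLift_eq (j : P.Jet1) (η : TSp n (P.proj j.pt) →L[ℝ] ℝ) (ζ : P.vertical j.pt) :
    j.verticalLift η ζ = ((0, coordLinear (P.preferredChart j.pt) j.pt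
        (η.smulRight (ζ : TSp (n + k) j.pt))) : JetModel n k) := by
  rw [verticalLift, (j.hasMFDerivAt_translate η ζ).mfderiv]
  exact one_smul ℝ _

/-- The vertical lift `α ⊙_j ω` of the vertical part `ω` of a vector `w` depends only on the jet `j`
and on `w`. -/
theorem mk_verticalLift_congr (α : ∀ x : M, TSp n x →L[ℝ] ℝ) {j j' : P.Jet1} (hj : j = j')
    {w : TSp (n + k) j.pt} {w' : TSp (n + k) j'.pt}
    (hw : (⟨j.pt, w⟩ : TangentBundle 𝓘(ℝ, EuclideanSpace ℝ (Fin (n + k))) E) = ⟨j'.pt, w'⟩) :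
    (⟨j, j.verticalLift (α (P.proj j.pt)) (j.verticalDifferential w)⟩ :
        TangentBundle 𝓘(ℝ, JetModel n k) P.Jet1) =
      ⟨j', j'.verticalLift (α (P.proj j'.pt)) (j'.verticalDifferential w')⟩ := by
  subst hj
  -- With one jet in place of two, both vectors lie in the same tangent space, and equality in the
  -- tangent bundle is equality of vectors.
  obtain rfl : w = w' := eq_of_heq (Bundle.TotalSpace.mk.inj hw).2
  rfl

end Jet1

/-! ### The projection `ρ` along unipotent curves -/

namespace AdaptedFrame

/-- `ρ` is the jet at the origin of `G_V/H`, the assignment of jets is compatible with the action by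
`jet_act`, and `(I 0; ξ I)` moves the origin to `ξ`. -/
theorem toJet_act_unipotent (u : P.AdaptedFrame) (ξ : Matrix (Fin k) (Fin n) ℝ) :
    (u.act (unipotent ξ)).toJet = u.jet ξ := by
  rw [toJet, jet_act, affineAction_unipotent_zero]

/-- The curve `t ↦ u · (I 0; tζ I)` is differentiable. -/
theorem mdifferentiableAt_act_unipotent (u : P.AdaptedFrame) (ζ : Matrix (Fin k) (Fin n) ℝ) :
    MDifferentiableAt 𝓘(ℝ, ℝ) 𝓘(ℝ, FrameModel n k)
      (fun t : ℝ => u.act (unipotent (t • ζ))) 0 := by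
  set c := P.preferredChart u.pt
  -- In frame coordinates only the vectors `e_i` move, and they do so with constant velocity.
  have h : (chartAt (FrameModel n k) (u.act (unipotent ((0 : ℝ) • ζ)))) ∘
      (fun t : ℝ => u.act (unipotent (t • ζ))) = fun t => (coord c u + t •
        ((0, fun i => ∑ A, ζ A i • c.dφ u.pt (u.frame (Sum.inr A)), 0) : FrameModel n k)) := by
    funext t
    refine Prod.ext (by simp [chartAt_coe, coord, act, c]) (Prod.ext ?_ ?_)
    · funext i
      refine (congrArg (c.dφ u.pt) (u.act_unipotent_frame_inl (t • ζ) i)).trans ?_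
      simp [coord, Finset.smul_sum, smul_smul]
    · funext A
      refine (congrArg (fun v => (c.dφ u.pt v).2) (u.act_unipotent_frame_inr (t • ζ) A)).trans ?_
      simp [coord]
  have h' := ((hasFDerivAt_id (𝕜 := ℝ) (0 : ℝ)).smul_const ((0, fun i => ∑ A, ζ A i •
    c.dφ u.pt (u.frame (Sum.inr A)), 0) : FrameModel n k)).const_add (coord c u)
  refine (HasFDerivAt.hasMFDerivAt_of_chartAt (f := fun t : ℝ => u.act (unipotent (t • ζ)))
    (h ▸ h') (.of_forall fun t => P.mem_preferredChart u.pt)).mdifferentiableAt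

theorem lift_zero_apply (u : P.AdaptedFrame) (i : Fin n) :
    u.lift 0 (P.dproj u.pt (u.frame (Sum.inl i))) = u.frame (Sum.inl i) :=
  (u.lift_apply 0 i).trans (by simp)

/-! ### Differentiability of `ρ` -/

/-- The linear map that takes the standard basis to the vectors `v`. -/
noncomputable def columns {m : ℕ} (v : Fin n → EuclideanSpace ℝ (Fin m)) :
    EuclideanSpace ℝ (Fin n) →L[ℝ] EuclideanSpace ℝ (Fin m) :=
  ∑ i, (EuclideanSpace.proj i : EuclideanSpace ℝ (Fin n) →L[ℝ] ℝ).smulRight (v i)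

theorem columns_apply {m : ℕ} (v : Fin n → EuclideanSpace ℝ (Fin m))
    (x : EuclideanSpace ℝ (Fin n)) : columns v x = ∑ i, x i • v i := by
  simp [columns]

/-- The projection `ρ` in coordinates. -/
noncomputable def toJetCoord (z : FrameModel n k) : JetModel n k :=
  (z.1, columns (fun i => (z.2.1 i).2) ∘L (columns fun i => (z.2.1 i).1).inverse)

/-- The columns `(v^i_j)` are the coordinates of the basis `ê_j`, so their matrix is invertible.
Thus `inverse` in `toJetCoord` is a true inverse at the coordinates of a frame, not its default
value zero. -/
theorem exists_columns_equiv (c : P.AdaptedChart) (u : P.AdaptedFrame)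
    (hu : u.pt ∈ c.φ.source) :
    ∃ K : EuclideanSpace ℝ (Fin n) ≃L[ℝ] EuclideanSpace ℝ (Fin n),
      (K : EuclideanSpace ℝ (Fin n) →L[ℝ] EuclideanSpace ℝ (Fin n)) =
        columns fun i => ((coord c u).2.1 i).1 := by
  obtain ⟨L, hL⟩ := c.exists_dψ_equiv (c.proj_mem _ hu)
  set b := u.baseFrame.map L.toLinearEquiv
  refine ⟨((EuclideanSpace.basisFun (Fin n) ℝ).toBasis.equiv b
    (Equiv.refl _)).toContinuousLinearEquiv, ?_⟩
  refine ContinuousLinearMap.coe_injective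
    ((EuclideanSpace.basisFun (Fin n) ℝ).toBasis.ext fun i => ?_)
  have h1 : ((EuclideanSpace.basisFun (Fin n) ℝ).toBasis.equiv b (Equiv.refl _))
      ((EuclideanSpace.basisFun (Fin n) ℝ).toBasis i) = b i := Module.Basis.equiv_apply _ _ _ _
  refine h1.trans ?_
  have h2 : b i = (c.dφ u.pt (u.frame (Sum.inl i))).1 := by
    rw [c.fst_dφ hu, ← hL, ← baseFrame_apply]
    rfl
  rw [h2]
  simp [columns_apply, coord]

/-- Since `ρ(u)` takes `ê_i` to `e_i`, its coordinate matrix takes the horizontal coordinates of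
`e_i` to the vertical ones. This is a matrix equation, solved by inverting the horizontal block. -/
theorem coord_toJet (c : P.AdaptedChart) (u : P.AdaptedFrame) (hu : u.pt ∈ c.φ.source) :
    Jet1.coord c u.toJet = toJetCoord (coord c u) := by
  obtain ⟨K, hK⟩ := exists_columns_equiv c u hu
  refine Prod.ext rfl ?_
  have h : (Jet1.coord c u.toJet).2 ∘L (K : EuclideanSpace ℝ (Fin n) →L[ℝ] _) =
      columns fun i => ((coord c u).2.1 i).2 := by
    ext1 x
    rw [hK, ContinuousLinearMap.comp_apply, columns_apply, columns_apply, map_sum]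
    refine Finset.sum_congr rfl fun i _ => ?_
    rw [map_smul]
    congr 1
    -- Evaluated at `ê_i`, this computes both coordinate blocks of `e_i` from the jet.
    have h1 := Jet1.dφ_τ c u.toJet hu (P.dproj u.pt (u.frame (Sum.inl i)))
    have h2 := (congrArg (c.dφ u.pt) (u.lift_zero_apply i)).symm.trans h1
    have h3 : ((coord c u).2.1 i).1 = _ := congrArg Prod.fst h2
    rw [h3]
    exact (congrArg Prod.snd h2).symm
  change _ = _ ∘L ContinuousLinearMap.inverse _
  rw [← h, ← hK]
  ext1 x
  simp

/-- The formula consists of linear maps, a composition and an inversion; the inversion is smooth at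
invertible maps, and a frame gives one. -/
theorem differentiableAt_toJetCoord (c : P.AdaptedChart) (u : P.AdaptedFrame)
    (hu : u.pt ∈ c.φ.source) : DifferentiableAt ℝ toJetCoord (coord c u) := by
  obtain ⟨K, hK⟩ := exists_columns_equiv c u hu
  have h1 : Differentiable ℝ fun z : FrameModel n k => columns fun i => (z.2.1 i).1 := by
    unfold columns; fun_prop
  have h2 : Differentiable ℝ fun z : FrameModel n k => columns fun i => (z.2.1 i).2 := by
    unfold columns; fun_prop
  have h3 : DifferentiableAt ℝ (ContinuousLinearMap.inverse :
      (EuclideanSpace ℝ (Fin n) →L[ℝ] EuclideanSpace ℝ (Fin n)) → _)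
      (columns fun i => ((coord c u).2.1 i).1) := by
    rw [← hK]
    exact (contDiffAt_map_inverse (n := 1) K).differentiableAt (by simp)
  exact differentiableAt_fst.prodMk ((h2 _).clm_comp (DifferentiableAt.comp (coord c u)
    (f := fun z : FrameModel n k => columns fun i => (z.2.1 i).1) (g := ContinuousLinearMap.inverse) h3 (h1 _)))

/-- Near `u`, `ρ` is the frame chart followed by `toJetCoord` and the inverse jet chart. The chain
rule for `ρ_*` along curves needs this. -/
theorem mdifferentiableAt_toJet (u : P.AdaptedFrame) :
    MDifferentiableAt 𝓘(ℝ, FrameModel n k) 𝓘(ℝ, JetModel n k)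
      (AdaptedFrame.toJet (P := P)) u := by
  have hs : u ∈ (chartAt (FrameModel n k) u).source := mem_chart_source _ u
  have h0 : toJetCoord (chartAt (FrameModel n k) u u) =
      chartAt (JetModel n k) u.toJet u.toJet :=
    (coord_toJet (P.preferredChart u.pt) u (P.mem_preferredChart u.pt)).symm
  have h1 : MDifferentiableAt 𝓘(ℝ, FrameModel n k) 𝓘(ℝ, FrameModel n k)
      (chartAt (FrameModel n k) u) u :=
    (mdifferentiable_chart (I := 𝓘(ℝ, FrameModel n k)) u).mdifferentiableAt hs
  have h2 : MDifferentiableAt 𝓘(ℝ, FrameModel n k) 𝓘(ℝ, JetModel n k)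
      toJetCoord (chartAt (FrameModel n k) u u) :=
    (differentiableAt_toJetCoord (P.preferredChart u.pt) u
      (P.mem_preferredChart u.pt)).mdifferentiableAt
  have h3 : MDifferentiableAt 𝓘(ℝ, JetModel n k) 𝓘(ℝ, JetModel n k)
      (chartAt (JetModel n k) u.toJet).symm (toJetCoord (chartAt (FrameModel n k) u u)) := by
    rw [h0]
    exact (mdifferentiable_chart (I := 𝓘(ℝ, JetModel n k)) u.toJet).mdifferentiableAt_symm
      (mem_chart_target _ _)
  refine (h3.comp u (h2.comp u h1)).congr_of_eventuallyEq ?_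
  filter_upwards [(chartAt (FrameModel n k) u).open_source.mem_nhds hs] with v hv
  -- Both chart domains consist of all points over the same adapted coordinate domain in `E`, so one
  -- membership serves the frame and its jet.
  have hv' : v.pt ∈ (P.preferredChart u.pt).φ.source := hv
  have h4 : toJetCoord (chartAt (FrameModel n k) u v) = chartAt (JetModel n k) u.toJet v.toJet :=
    (coord_toJet _ v hv').symm
  simp only [Function.comp_apply, h4]
  exact ((chartAt (JetModel n k) u.toJet).left_inv hv').symm

/-! ### The pushed tensor as a vertical lift -/

/-- The component `ê^i` of the dual basis of `ê_i = π_*(e)(e_i)`. -/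
noncomputable def dualCoord (u : P.AdaptedFrame) (i : Fin n) : TSp n (P.proj u.pt) →L[ℝ] ℝ :=
  have : FiniteDimensional ℝ (TSp n (P.proj u.pt)) :=
    inferInstanceAs (FiniteDimensional ℝ (EuclideanSpace ℝ (Fin n)))
  have : T2Space (TSp n (P.proj u.pt)) := inferInstanceAs (T2Space (EuclideanSpace ℝ (Fin n)))
  ⟨u.baseFrame.coord i, LinearMap.continuous_of_finiteDimensional _⟩

theorem dualCoord_apply (u : P.AdaptedFrame) (i j : Fin n) :
    u.dualCoord i (P.dproj u.pt (u.frame (Sum.inl j))) = if j = i then 1 else 0 := by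
  rw [← baseFrame_apply]
  change u.baseFrame.coord i _ = _
  simp [Finsupp.single_apply]

/-- On the basis `ê_j` both sides give `e_j`, plus `t e_B` when `j = i`. -/
theorem jet_eq_translate (u : P.AdaptedFrame) (i : Fin n) (B : Fin k) (t : ℝ) :
    u.jet (t • Matrix.single B i 1) =
      u.toJet.translate (u.dualCoord i) ⟨u.frame (Sum.inr B), u.vertical B⟩ t := by
  have h : (⟨u.lift (t • Matrix.single B i 1), u.continuous_lift _⟩ :
      TSp n (P.proj u.pt) →L[ℝ] TSp (n + k) u.pt) =
      (u.toJet.translate (u.dualCoord i) ⟨u.frame (Sum.inr B), u.vertical B⟩ t).τ := by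
    refine ContinuousLinearMap.coe_injective (u.baseFrame.ext fun j => ?_)
    rw [baseFrame_apply]
    refine (u.lift_apply _ j).trans ?_
    refine Eq.trans ?_ (congrArg₂ (· + ·) (u.lift_zero_apply j).symm (congrArg
      (fun a => t • a • u.frame (Sum.inr B)) (u.dualCoord_apply i j).symm))
    simp [Matrix.single, ite_and, eq_comm]
  change Jet1.mk u.pt ⟨u.lift _, u.continuous_lift _⟩ _ = Jet1.mk u.pt _ _
  congr 1

/-- The heart of the proof: `ρ` carries the curve that defines `E^{*i}_B` to the curve `τ + t ê^i ⊗
e_B` that defines the vertical lift, and the chain rule compares their velocities. -/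
theorem dtoJet_fundamentalField (u : P.AdaptedFrame) (i : Fin n) (B : Fin k) :
    u.dtoJet (fundamentalField (structureBasis i B) u) =
      u.toJet.verticalLift (u.dualCoord i) ⟨u.frame (Sum.inr B), u.vertical B⟩ := by
  refine mfderiv_mfderiv_curve ?_ ?_ u.mdifferentiableAt_toJet ?_
  · rw [structureExp_smul_structureBasis, zero_smul, act_unipotent_zero]
  · simp only [structureExp_smul_structureBasis]
    exact u.mdifferentiableAt_act_unipotent (Matrix.single B i 1)
  · funext t
    rw [Function.comp_apply, structureExp_smul_structureBasis, toJet_act_unipotent,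
      jet_eq_translate]

/-- The vertical part of a vector with respect to the splitting defined by a jet. -/
theorem verticalDifferential_toJet (u : P.AdaptedFrame) (v : TSp (n + k) u.pt) :
    (u.toJet.verticalDifferential v).1 =
      ∑ B, u.frame.coord (Sum.inr B) v • u.frame (Sum.inr B) := by
  -- The composite of `π_*` and the jet fixes each `e_i` and kills each `e_A`.
  refine u.frame.sub_apply_eq_sum_inr (u.lift 0 ∘ₗ (P.dproj u.pt).toLinearMap)
    u.lift_zero_apply (fun A => ?_) v
  exact (congrArg (u.lift 0) (u.vertical A)).trans (map_zero _)

theorem sum_dualCoord (u : P.AdaptedFrame) (η : TSp n (P.proj u.pt) →L[ℝ] ℝ) :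
    ∑ i, η (P.dproj u.pt (u.frame (Sum.inl i))) • u.dualCoord i = η := by
  refine ContinuousLinearMap.coe_injective (u.baseFrame.ext fun j => ?_)
  rw [baseFrame_apply]
  simp [dualCoord_apply]

/-- Both sides are the image under one linear map of the same tensor: `α` has the coefficients
`(π^*α)(e_i)` in the dual basis, and the vertical part of `λ_* X` has the coefficients `θ^B(X)`. -/
theorem dtoJet_sum (α : ∀ x : M, TSp n x →L[ℝ] ℝ) (u : P.AdaptedFrame)
    (X : TangentSpace 𝓘(ℝ, FrameModel n k) u) :
    u.dtoJet (∑ i : Fin n, pullback P α u.pt (u.frame (Sum.inl i)) • tangentTensor i u X) =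
      u.toJet.verticalLift (α (P.proj u.pt)) (u.toJet.verticalDifferential (u.dpt X)) := by
  -- `Λ σ` is the velocity of `τ + tσ` in jet coordinates.
  set Λ : (TSp n (P.proj u.pt) →L[ℝ] TSp (n + k) u.pt) →ₗ[ℝ] JetModel n k :=
    LinearMap.inr ℝ _ _ ∘ₗ Jet1.coordLinear (P.preferredChart u.pt) u.pt
  have h1 : ∀ i B, u.dtoJet (fundamentalField (structureBasis i B) u) =
      Λ ((u.dualCoord i).smulRight (u.frame (Sum.inr B))) := fun i B =>
    (u.dtoJet_fundamentalField i B).trans (Jet1.verticalLift_eq _ _ _)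
  have h2 : u.toJet.verticalLift (α (P.proj u.pt)) (u.toJet.verticalDifferential (u.dpt X)) =
      Λ ((α (P.proj u.pt)).smulRight (u.toJet.verticalDifferential (u.dpt X)).1) :=
    Jet1.verticalLift_eq _ _ _
  -- Only the linearity of `Λ` is used from here on.
  clear_value Λ
  have h3 := ContinuousLinearMap.sum_smulRight_sum
    (fun i => α (P.proj u.pt) (P.dproj u.pt (u.frame (Sum.inl i)))) u.dualCoord
    (fun B => soldering (Sum.inr B) u X) (fun B => u.frame (Sum.inr B))
  rw [sum_dualCoord] at h3
  have h4 := (congrArg (fun v => Λ ((α (P.proj u.pt)).smulRight v))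
    (u.verticalDifferential_toJet (u.dpt X))).trans (congrArg Λ h3)
  refine Eq.trans ?_ (h2.trans h4).symm
  simp only [map_sum, map_smul]
  refine Finset.sum_congr rfl fun i _ => ?_
  simp only [tangentTensor, map_sum, map_smul, Finset.smul_sum, h1]
  rfl

/-- The right-hand side sees the representative `(u, ξ)` only through the jet `ρ(u·ξ)` and the
vector projected to `E`; both claims follow from this form. -/
theorem pushedTensor_eq (α : ∀ x : M, TSp n x →L[ℝ] ℝ) (u : P.AdaptedFrame)
    (ξ : Matrix (Fin k) (Fin n) ℝ)
    (X : TangentSpace 𝓘(ℝ, FrameModel n k) (u.act (unipotent ξ))) :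
    u.pushedTensor α ξ X = (u.act (unipotent ξ)).toJet.verticalLift (α (P.proj u.pt))
      ((u.act (unipotent ξ)).toJet.verticalDifferential ((u.act (unipotent ξ)).dpt X)) := by
  refine Eq.trans ?_ (dtoJet_sum α (u.act (unipotent ξ)) X)
  unfold pushedTensor
  congr 1
  refine Finset.sum_congr rfl fun i _ => ?_
  congr 1
  exact congrArg (α (P.proj u.pt)) (u.dproj_act_unipotent ξ i).symm

end AdaptedFrame

end SmoothFiberBundle

/-! ### The proposition -/

/-- The vectors compared lie over jets that are equal but not definitionally so. Equality in the
tangent bundle also asserts equality of the jets, so the first claim includes `ρ(u·ξ) = [u, ξ]`. -/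
theorem mainTheorem5 {n k : ℕ} {F E M : Type*}
    [TopologicalSpace F] [ChartedSpace (EuclideanSpace ℝ (Fin k)) F]
    [TopologicalSpace E] [ChartedSpace (EuclideanSpace ℝ (Fin (n + k))) E]
    [TopologicalSpace M] [ChartedSpace (EuclideanSpace ℝ (Fin n)) M]
    [IsManifold 𝓘(ℝ, EuclideanSpace ℝ (Fin k)) ∞ F]
    [IsManifold 𝓘(ℝ, EuclideanSpace ℝ (Fin (n + k))) ∞ E]
    [IsManifold 𝓘(ℝ, EuclideanSpace ℝ (Fin n)) ∞ M]
    (P : SmoothFiberBundle n k F E M) (α : ∀ x : M, TSp n x →L[ℝ] ℝ)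
    (u : P.AdaptedFrame) (ξ : Matrix (Fin k) (Fin n) ℝ) :
    (∀ (X : TangentSpace 𝓘(ℝ, JetModel n k) (jetClass u ξ).toJet)
      (X' : TangentSpace 𝓘(ℝ, FrameModel n k)
        (u.act (unipotent ξ))),
      Jet1.dpt _ X = AdaptedFrame.dpt _ X' →
      (⟨(jetClass u ξ).toJet,
          (jetClass u ξ).toJet.verticalEndomorphism α X⟩ :
          TangentBundle 𝓘(ℝ, JetModel n k) P.Jet1) =
        ⟨(u.act (unipotent ξ)).toJet, u.pushedTensor α ξ X'⟩) ∧
    (∀ (v : P.AdaptedFrame) (ζ : Matrix (Fin k) (Fin n) ℝ)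
      (X : TangentSpace 𝓘(ℝ, FrameModel n k)
        (u.act (unipotent ξ)))
      (Y : TangentSpace 𝓘(ℝ, FrameModel n k)
        (v.act (unipotent ζ))),
      jetClass u ξ = jetClass v ζ →
      (⟨u.pt, (u.act (unipotent ξ)).dpt X⟩ :
          TangentBundle 𝓘(ℝ, EuclideanSpace ℝ (Fin (n + k))) E) =
        ⟨v.pt, (v.act (unipotent ζ)).dpt Y⟩ →
      (⟨(u.act (unipotent ξ)).toJet, u.pushedTensor α ξ X⟩ :
          TangentBundle 𝓘(ℝ, JetModel n k) P.Jet1) =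
        ⟨(v.act (unipotent ζ)).toJet, v.pushedTensor α ζ Y⟩) := by
  have hj : (u.act (unipotent ξ)).toJet = (jetClass u ξ).toJet := u.toJet_act_unipotent ξ
  refine ⟨fun X X' h => ?_, fun v ζ X Y hjet h => ?_⟩
  · rw [AdaptedFrame.pushedTensor_eq]
    -- By definition `S_α` is the vertical lift of `α` and the vertical part of the projected
    -- vector, so both sides have the same form.
    exact Jet1.mk_verticalLift_congr α hj.symm (congrArg (Bundle.TotalSpace.mk u.pt) h)
  · have hj' : (v.act (unipotent ζ)).toJet = (jetClass v ζ).toJet := v.toJet_act_unipotent ζ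
    rw [AdaptedFrame.pushedTensor_eq, AdaptedFrame.pushedTensor_eq]
    -- Equal classes give equal jets because the identification with `J¹π` is defined on the
    -- quotient.
    exact Jet1.mk_verticalLift_congr α (hj.trans ((congrArg _ hjet).trans hj'.symm)) h
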